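/- Let $M$ be a smooth $d$-dimensional manifold with a Weyl class $[g,a]$, i.e. the set of all pairs $(\mathcal B^{-2}g,\,a-\mathrm d\ln\mathcal B)$, where $g$ is a smooth metric of signature $(p,q)$, $a$ a smooth one-form and $\mathcal B>0$ runs over the smooth positive functions on $M$. Fix any representative $(g,a)$ and use it to identify the bundle $\mathcal P_W\cong\{(x,s^2g_x): x\in M,\ s>0\}$ with $\mathbb R_+\times M$ by $(t,x)\leftrightarrow(x,t^2g_x)$; write $\mathbf g_0=t^2g_{ij}(x)\,\mathrm dx^i\mathrm dx^j$, $\delta_s(t,x,\rho)=(st,x,\rho)$, $\mathcal T=t\partial_t$, and use $0,i,\infty$ for the components along $t,x^i,\rho$. A Weyl-ambient space $(\tilde M,\tilde g)$ for $(M,[g,a])$ is a $\delta_s$-invariant open neighbourhood $\tilde M$ of $\mathcal P_W\times\{0\}$ in $\mathcal P_W\times\mathbb R$ with a smooth metric $\tilde g$ of signature $(p+1,q+1)$ such that $\delta_s^*\tilde g=s^2\tilde g$ for all $s>0$, the pullback of $\tilde g$ to $\mathcal P_W\times\{0\}$ is $\mathbf g_0$, and $\mathrm{Ric}(\tilde g)$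 vanishes to infinite order at every point of $\mathcal P_W\times\{0\}$. It is in Weyl-normal form with acceleration $\mathcal A$ (relative to $(g,a)$) if for each $p\in\mathcal P_W$ the set $\{\rho:(p,\rho)\in\tilde M\}$ is an open interval containing $0$; the tangent field $U=\partial_\rho$ of the lines $\rho\mapsto(p,\rho)$ has acceleration $\mathcal A=\tilde\nabla_UU$ with $\tilde g(\mathcal T,\mathcal A)=0$ and $\tilde g(U,\mathcal A)=0$; and $\tilde g|_{\rho=0}=\mathbf g_0+2t^2(t^{-1}\mathrm dt+a_i(x)\,\mathrm dx^i)\,\mathrm d\rho$. Theorem. Let $(\tilde M,\tilde g)$ be a Weyl-ambient space for $(M,[g,a])$ in Weyl-normal form with acceleration $\mathcal A$. Then $a_i(x,\rho):=a_i(x)+t^{-2}\int_0^\rho\mathcal A_i(t,x,\rho')\,\mathrm d\rho'$ does not depend on $t$, and there is a smooth family $g_{ij}(x,\rho)$ of symmetric tensors on $M$ with $g_{ij}(x,0)=g_{ij}(x)$ such that $$\tilde g=2\rho\,\mathrm dt^2+2t^2\,\mathrm d\rho\Big(\frac{\mathrm dt}{t}+a_i(x,\rho)\,\mathrm dx^i\Big)+t^2g_{ij}(x,\rho)\,\mathrm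 dx^i\,\mathrm dx^j$$ in the following sense. The components $\tilde g_{0\infty}=t$, $\tilde g_{i\infty}=t^2a_i(x,\rho)$, $\tilde g_{\infty\infty}=0$ and $\tilde g_{ij}=t^2g_{ij}(x,\rho)$ are exact on $\tilde M$, and the remaining equations $\tilde g_{00}=2\rho$ and $\tilde g_{0i}=0$ hold to all orders at $\rho=0$ (the difference of the two sides of the displayed formula vanishes to infinite order at every point of $\mathcal P_W\times\{0\}$) if $d$ is odd. If $d$ is even, they hold to order $d/2$ (all derivatives of the difference of order at most $d/2$ vanish there). -/

import Mathlib

open scoped Manifold ContDiff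

noncomputable section

namespace WeylAmbient

/-- The model space of a `d`-dimensional manifold. -/
abbrev Eucl (d : ℕ) : Type := EuclideanSpace ℝ (Fin d)

/-! ### Metrics, one-forms and Weyl classes on a `d`-dimensional manifold `M` -/

/-- The coordinate vector field `∂_i` of the chart around `x₀`, at the point of `M` with
coordinates `y`. -/
def coordVec {d : ℕ} {M : Type*} [TopologicalSpace M] [ChartedSpace (Eucl d) M]
    (x₀ : M) (y : Eucl d) (i : Fin d) :
    TangentSpace (𝓡 d) ((extChartAt (𝓡 d) x₀).symm y) :=
  mfderiv (𝓡 d) (𝓡 d) (extChartAt (𝓡 d) x₀).symm y (EuclideanSpace.single i (1 : ℝ))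

/-- A symmetric bilinear form is nondegenerate of signature `(p, q)`. -/
def HasSignature {V : Type*} [AddCommGroup V] [Module ℝ V]
    (B : LinearMap.BilinForm ℝ V) (p q : ℕ) : Prop :=
  B.IsSymm ∧ B.Nondegenerate ∧ sigPos B.toQuadraticMap = p ∧ sigNeg B.toQuadraticMap = q

/-- A smooth pseudo-Riemannian metric of signature `(p, q)` on `M`. -/
structure PseudoMetric (d : ℕ) (M : Type*) [TopologicalSpace M] [ChartedSpace (Eucl d) M]
    (p q : ℕ) where
  form : ∀ x : M, LinearMap.BilinForm ℝ (TangentSpace (𝓡 d) x)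
  signature : ∀ x : M, HasSignature (form x) p q
  smooth : ∀ (x₀ : M) (i j : Fin d),
    ContDiffOn ℝ ∞ (fun y : Eucl d => form ((extChartAt (𝓡 d) x₀).symm y)
      (coordVec x₀ y i) (coordVec x₀ y j)) (extChartAt (𝓡 d) x₀).target

/-- A smooth one-form `a = a_i dx^i` on `M`. -/
structure OneForm (d : ℕ) (M : Type*) [TopologicalSpace M] [ChartedSpace (Eucl d) M] where
  form : ∀ x : M, TangentSpace (𝓡 d) x →ₗ[ℝ] ℝ
  smooth : ∀ (x₀ : M) (i : Fin d),
    ContDiffOn ℝ ∞ (fun y : Eucl d => form ((extChartAt (𝓡 d) x₀).symm y) (coordVec x₀ y i))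
      (extChartAt (𝓡 d) x₀).target

/-- A pair `(g, a)` of a metric and a Weyl connection one-form. -/
structure WeylPair (d : ℕ) (M : Type*) [TopologicalSpace M] [ChartedSpace (Eucl d) M]
    (p q : ℕ) where
  g : PseudoMetric d M p q
  a : OneForm d M

/-- The differential `d ln B` at `x`. -/
def dLog {d : ℕ} {M : Type*} [TopologicalSpace M] [ChartedSpace (Eucl d) M]
    (B : M → ℝ) (x : M) : TangentSpace (𝓡 d) x →L[ℝ] ℝ :=
  mfderiv (𝓡 d) 𝓘(ℝ, ℝ) (fun x' => Real.log (B x')) x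

/-- `(g', a') = (𝓑⁻² g, a - d ln 𝓑)` for some smooth positive function `𝓑` on `M`. -/
def WeylRelated {d : ℕ} {M : Type*} [TopologicalSpace M] [ChartedSpace (Eucl d) M] {p q : ℕ}
    (r r' : WeylPair d M p q) : Prop :=
  ∃ B : M → ℝ, ContMDiff (𝓡 d) 𝓘(ℝ, ℝ) ∞ B ∧ (∀ x, 0 < B x) ∧
    (∀ (x : M) (v w : TangentSpace (𝓡 d) x),
      r'.g.form x v w = (B x ^ 2)⁻¹ * r.g.form x v w) ∧
    (∀ (x : M) (v : TangentSpace (𝓡 d) x),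
      r'.a.form x v = r.a.form x v - dLog B x v)

/-- A Weyl class `[g, a]`: all pairs related to a given one by a Weyl transformation. -/
def IsWeylClass {d : ℕ} {M : Type*} [TopologicalSpace M] [ChartedSpace (Eucl d) M] {p q : ℕ}
    (C : Set (WeylPair d M p q)) : Prop :=
  ∃ r : WeylPair d M p q, C = {r' | WeylRelated r r'}

/-! ### The space `𝓟_W × ℝ`

The Weyl structure `𝓟_W` is the principal `ℝ₊`-bundle over `M` isomorphic to the metric bundle
`{(x, s² g_x)}`. A representative `g` trivializes it globally, by identifying `(t, x)`, `t > 0`,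
with `(x, t² g_x)`; the dilatations become `δ_s (t, x) = (s t, x)`. A point of `𝓟_W × ℝ` is thus a
triple `(t, x, ρ) : ℝ × M × ℝ` with `0 < t`. -/

/-- The tangent space of `ℝ₊ × M × ℝ` at `(t, x, ρ)`: triples of a `t`-component, a vector tangent
to `M` and a `ρ`-component. -/
abbrev Tan {d : ℕ} {M : Type*} [TopologicalSpace M] [ChartedSpace (Eucl d) M]
    (z : ℝ × M × ℝ) : Type :=
  ℝ × TangentSpace (𝓡 d) z.2.1 × ℝ

/-- A field of bilinear forms on `ℝ₊ × M × ℝ`. -/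
abbrev BilinField (d : ℕ) (M : Type*) [TopologicalSpace M] [ChartedSpace (Eucl d) M] : Type _ :=
  ∀ z : ℝ × M × ℝ, LinearMap.BilinForm ℝ (Tan (d := d) z)

/-- The tautological tensor `𝐠₀ = t² π^* g` of `𝓟_W` at `(t, x)`:
it is `h(π_* w₁, π_* w₂)` with `h = t² g_x`. -/
def tautological {d : ℕ} {M : Type*} [TopologicalSpace M] [ChartedSpace (Eucl d) M] {p q : ℕ}
    (g : PseudoMetric d M p q) (t : ℝ) (x : M) (w₁ w₂ : ℝ × TangentSpace (𝓡 d) x) : ℝ :=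
  (t ^ 2 • g.form x) w₁.2 w₂.2

/-! ### Ambient coordinates `(t, x^i, ρ)` -/

/-- The indices `0, i, ∞` of the ambient coordinates. -/
abbrev Idx (d : ℕ) : Type := Unit ⊕ Fin d ⊕ Unit

/-- The index `∞` of the coordinate `ρ`. -/
abbrev idxInf (d : ℕ) : Idx d := Sum.inr (Sum.inr ())

/-- The space in which the ambient coordinates `(t, x^i, ρ)` take their values. -/
abbrev Coord (d : ℕ) : Type := ℝ × Eucl d × ℝ

/-- The standard basis of the coordinate space. -/
def stdVec {d : ℕ} : Idx d → Coord d
  | Sum.inl _ => (1, 0, 0)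
  | Sum.inr (Sum.inl i) => (0, EuclideanSpace.single i 1, 0)
  | Sum.inr (Sum.inr _) => (0, 0, 1)

/-- The partial derivative `∂_I f`. -/
def pd {d : ℕ} (I : Idx d) (f : Coord d → ℝ) (z : Coord d) : ℝ :=
  fderiv ℝ f z (stdVec I)

/-- The point with ambient coordinates `z`, for the chart of `M` around `x₀`. -/
def ambPoint {d : ℕ} {M : Type*} [TopologicalSpace M] [ChartedSpace (Eucl d) M]
    (x₀ : M) (z : Coord d) : ℝ × M × ℝ :=
  (z.1, (extChartAt (𝓡 d) x₀).symm z.2.1, z.2.2)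

/-- The ambient coordinate vector fields `∂_t, ∂_i, ∂_ρ`. -/
def ambFrame {d : ℕ} {M : Type*} [TopologicalSpace M] [ChartedSpace (Eucl d) M]
    (x₀ : M) (z : Coord d) : Idx d → Tan (d := d) (ambPoint x₀ z)
  | Sum.inl _ => (1, 0, 0)
  | Sum.inr (Sum.inl i) => (0, coordVec x₀ z.2.1 i, 0)
  | Sum.inr (Sum.inr _) => (0, 0, 1)

/-- The components of a field of bilinear forms in ambient coordinates. -/
def comp {d : ℕ} {M : Type*} [TopologicalSpace M] [ChartedSpace (Eucl d) M]
    (x₀ : M) (G : BilinField d M) (I J : Idx d) (z : Coord d) : ℝ :=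
  G (ambPoint x₀ z) (ambFrame x₀ z I) (ambFrame x₀ z J)

/-- The part of the coordinate space that corresponds to the subset `N` of `ℝ₊ × M × ℝ`. -/
def coordDomain {d : ℕ} {M : Type*} [TopologicalSpace M] [ChartedSpace (Eucl d) M]
    (x₀ : M) (N : Set (ℝ × M × ℝ)) : Set (Coord d) :=
  {z | z.2.1 ∈ (extChartAt (𝓡 d) x₀).target ∧ ambPoint x₀ z ∈ N}

/-- The Christoffel symbols `Γ^K_{IJ}` of the Levi-Civita connection of the metric with
components `G`. -/
def christoffel {d : ℕ} (G : Idx d → Idx d → Coord d → ℝ) (K I J : Idx d) (z : Coord d) : ℝ :=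
  (1 / 2) * ∑ L, (Matrix.of fun I' J' => G I' J' z)⁻¹ K L *
    (pd I (G J L) z + pd J (G I L) z - pd L (G I J) z)

/-- The components of the Ricci tensor of the metric with components `G`. -/
def ricci {d : ℕ} (G : Idx d → Idx d → Coord d → ℝ) (I J : Idx d) (z : Coord d) : ℝ :=
  ∑ K, (pd K (christoffel G K I J) z - pd J (christoffel G K I K) z) +
    ∑ K, ∑ L, (christoffel G K K L z * christoffel G L I J z -
      christoffel G K J L z * christoffel G L I K z)

/-- The `K`-th component of the Levi-Civita covariant derivative `∇_X Y`, for vector fields `X`,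
`Y` given by their components. -/
def covDeriv {d : ℕ} (G : Idx d → Idx d → Coord d → ℝ) (X Y : Idx d → Coord d → ℝ)
    (K : Idx d) (z : Coord d) : ℝ :=
  ∑ I, X I z * (pd I (Y K) z + ∑ J, christoffel G K I J z * Y J z)

/-- The components of `∂_ρ`, the tangent vector field of the curves `ρ ↦ (p, ρ)`. -/
def rhoField {d : ℕ} (I : Idx d) (_ : Coord d) : ℝ := if I = idxInf d then 1 else 0

/-- A tensor with components `F x₀ I J` in the ambient coordinates of the chart around `x₀`
vanishes to order `m` at every point of `𝓟_W × {0}`: all partial derivatives of order at most `m`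
of its components are zero there. -/
def VanishesToOrder {d : ℕ} {M : Type*} [TopologicalSpace M] [ChartedSpace (Eucl d) M]
    (F : M → Idx d → Idx d → Coord d → ℝ) (m : ℕ) : Prop :=
  ∀ (x₀ : M) (t : ℝ) (y : Eucl d), 0 < t → y ∈ (extChartAt (𝓡 d) x₀).target →
    ∀ (I J : Idx d) (k : ℕ), k ≤ m → iteratedFDeriv ℝ k (F x₀ I J) (t, y, 0) = 0

/-! ### Weyl-ambient spaces -/

/-- `(N, G)` is a Weyl pre-ambient space for the class of `r = (g, a)`, written in the
trivialization induced by `g`. -/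
structure IsWeylPreAmbient {d : ℕ} {M : Type*} [TopologicalSpace M] [ChartedSpace (Eucl d) M]
    {p q : ℕ} (r : WeylPair d M p q) (N : Set (ℝ × M × ℝ)) (G : BilinField d M) : Prop where
  isOpen : IsOpen N
  pos : ∀ z ∈ N, 0 < z.1
  contains_zero : ∀ (t : ℝ) (x : M), 0 < t → (t, x, 0) ∈ N
  dilatation : ∀ (s t : ℝ) (x : M) (ρ : ℝ), 0 < s → (t, x, ρ) ∈ N → (s * t, x, ρ) ∈ N
  pullback : ∀ (t : ℝ) (x : M), 0 < t → ∀ w₁ w₂ : ℝ × TangentSpace (𝓡 d) x,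
    G (t, x, 0) (w₁.1, w₁.2, 0) (w₂.1, w₂.2, 0) = tautological r.g t x w₁ w₂
  signature : ∀ z ∈ N, HasSignature (G z) (p + 1) (q + 1)
  smooth : ∀ (x₀ : M) (I J : Idx d), ContDiffOn ℝ ∞ (comp x₀ G I J) (coordDomain x₀ N)
  homogeneous : ∀ (s t : ℝ) (x : M) (ρ : ℝ), 0 < s → (t, x, ρ) ∈ N →
    ∀ (τ σ : ℝ) (v w : TangentSpace (𝓡 d) x) (α β : ℝ),
      G (s * t, x, ρ) (s * τ, v, α) (s * σ, w, β) = s ^ 2 * G (t, x, ρ) (τ, v, α) (σ, w, β)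

/-- A Weyl-ambient space: in addition, the Ricci tensor vanishes to infinite order at every point
of `𝓟_W × {0}`. -/
structure IsWeylAmbient {d : ℕ} {M : Type*} [TopologicalSpace M] [ChartedSpace (Eucl d) M]
    {p q : ℕ} (r : WeylPair d M p q) (N : Set (ℝ × M × ℝ)) (G : BilinField d M) : Prop
    extends IsWeylPreAmbient r N G where
  ricciFlat : ∀ m : ℕ, VanishesToOrder (M := M) (fun x₀ => ricci (comp x₀ G)) m

/-- `(N, G)` is in Weyl-normal form with acceleration `A`, relative to `r = (g, a)`. -/
structure IsWeylNormalForm {d : ℕ} {M : Type*} [TopologicalSpace M] [ChartedSpace (Eucl d) M]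
    {p q : ℕ} (r : WeylPair d M p q) (N : Set (ℝ × M × ℝ)) (G : BilinField d M)
    (A : ∀ z : ℝ × M × ℝ, Tan (d := d) z) : Prop where
  /-- Over each point of `𝓟_W`, the values of `ρ` form an open interval containing `0`. -/
  interval : ∀ (t : ℝ) (x : M), 0 < t →
    IsOpen {ρ : ℝ | (t, x, ρ) ∈ N} ∧ {ρ : ℝ | (t, x, ρ) ∈ N}.OrdConnected ∧ (t, x, 0) ∈ N
  /-- `A = ∇_U U`, where `U = ∂_ρ`. -/
  acceleration : ∀ (x₀ : M), ∀ z ∈ coordDomain x₀ N,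
    A (ambPoint x₀ z) = ∑ K, covDeriv (comp x₀ G) rhoField rhoField K z • ambFrame x₀ z K
  /-- `A` is orthogonal to `𝒯 = t ∂_t`. -/
  orthogonal_dilatation : ∀ z ∈ N, G z (z.1, 0, 0) (A z) = 0
  /-- `A` is orthogonal to `U` (this fixes the parametrization of the `ρ`-lines). -/
  orthogonal_tangent : ∀ z ∈ N, G z (0, 0, 1) (A z) = 0
  /-- At `ρ = 0` the metric is `𝐠₀ + 2 t² (t⁻¹ dt + a_i dx^i) dρ`. -/
  initial : ∀ (t : ℝ) (x : M), 0 < t →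
    ∀ (τ σ : ℝ) (v w : TangentSpace (𝓡 d) x) (α β : ℝ),
      G (t, x, 0) (τ, v, α) (σ, w, β) = tautological r.g t x (τ, v) (σ, w)
        + t ^ 2 * ((t⁻¹ * τ + r.a.form x v) * β + (t⁻¹ * σ + r.a.form x w) * α)

/-! ### The Weyl-ambient metric -/

/-- `2 ρ dt² + 2 t² dρ (dt / t + a_i(x, ρ) dx^i) + t² g_ij(x, ρ) dx^i dx^j`, where a product of two
one-forms is the symmetric product `αβ = (α ⊗ β + β ⊗ α) / 2`. -/
def weylAmbientForm {d : ℕ} {M : Type*} [TopologicalSpace M] [ChartedSpace (Eucl d) M]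
    (a : ∀ x : M, ℝ → TangentSpace (𝓡 d) x →ₗ[ℝ] ℝ)
    (g : ∀ x : M, ℝ → LinearMap.BilinForm ℝ (TangentSpace (𝓡 d) x)) : BilinField d M :=
  fun z =>
    let t := z.1
    let ρ := z.2.2
    let dt : Tan (d := d) z →ₗ[ℝ] ℝ := LinearMap.fst ℝ _ _
    let dx : Tan (d := d) z →ₗ[ℝ] TangentSpace (𝓡 d) z.2.1 :=
      LinearMap.fst ℝ _ _ ∘ₗ LinearMap.snd ℝ _ _
    let dρ : Tan (d := d) z →ₗ[ℝ] ℝ := LinearMap.snd ℝ _ _ ∘ₗ LinearMap.snd ℝ _ _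
    let n : Tan (d := d) z →ₗ[ℝ] ℝ := t⁻¹ • dt + a z.2.1 ρ ∘ₗ dx
    (2 * ρ) • LinearMap.BilinForm.linMulLin dt dt
      + t ^ 2 • (LinearMap.BilinForm.linMulLin dρ n + LinearMap.BilinForm.linMulLin n dρ)
      + t ^ 2 • (g z.2.1 ρ).compl₁₂ dx dx

/-- `a_i(x, ρ)` and `g_ij(x, ρ)` are smooth functions of `(x, ρ)` wherever `(t, x, ρ) ∈ N` for some
`t`. -/
def SmoothFamilies {d : ℕ} {M : Type*} [TopologicalSpace M] [ChartedSpace (Eucl d) M]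
    (N : Set (ℝ × M × ℝ)) (a : ∀ x : M, ℝ → TangentSpace (𝓡 d) x →ₗ[ℝ] ℝ)
    (g : ∀ x : M, ℝ → LinearMap.BilinForm ℝ (TangentSpace (𝓡 d) x)) : Prop :=
  ∀ x₀ : M,
    let D : Set (Eucl d × ℝ) := {y | y.1 ∈ (extChartAt (𝓡 d) x₀).target ∧
      ∃ t : ℝ, (t, (extChartAt (𝓡 d) x₀).symm y.1, y.2) ∈ N}
    (∀ i : Fin d, ContDiffOn ℝ ∞
      (fun y : Eucl d × ℝ => a ((extChartAt (𝓡 d) x₀).symm y.1) y.2 (coordVec x₀ y.1 i)) D) ∧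
    (∀ i j : Fin d, ContDiffOn ℝ ∞
      (fun y : Eucl d × ℝ => g ((extChartAt (𝓡 d) x₀).symm y.1) y.2
        (coordVec x₀ y.1 i) (coordVec x₀ y.1 j)) D)

end WeylAmbient

end

/-!
In coordinates `(t, x, ρ)` the generator `T = t ∂_t` of the dilatations is a homothety, so that
`∇T = id + ω` with `ω` half the exterior derivative of the dual one-form `T♭`. The Ricci identity
then turns `Ric(T, ·)` into the divergence of `ω`: Ricci flatness is a Maxwell equation for `T♭`,
whose components are `t G_{00}`, `t G_{0i}` and `t G_{0∞} = t²`. If `G_{00} - 2ρ` and `G_{0i}` are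
of order `O(ρ^{n+1})`, the leading terms of this equation determine first the `ρ`-derivative of
`G_{00}` and then that of `G_{0i}` to one order more. The coefficient in the last step is
`n - d / 2`, which vanishes only for `2n = d`, and this is where the induction stops in even
dimensions.

The components `G_{∞I}` are exact because `∂_ρ G_{∞I}` is the `I`-component of the acceleration up
to terms that vanish by its orthogonality to `T` and `∂_ρ`, and the `t`-dependence of all
components is dictated by homogeneity.
-/

open TopologicalSpace (Opens)

noncomputable section

namespace WeylAmbient

/-! ### Partial derivatives of smooth functions on an open set -/

section PartialDerivatives

variable {d : ℕ} {Ω : Opens (Coord d)} {f g : Coord d → ℝ} {z : Coord d}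

theorem differentiableAt_of_contDiffOn (hf : ContDiffOn ℝ ∞ f Ω) (hz : z ∈ Ω) :
    DifferentiableAt ℝ f z :=
  (hf.contDiffAt (Ω.isOpen.mem_nhds hz)).differentiableAt (by simp)

theorem contDiffOn_pd (hf : ContDiffOn ℝ ∞ f Ω) (I : Idx d) : ContDiffOn ℝ ∞ (pd I f) Ω :=
  (hf.fderiv_of_isOpen Ω.isOpen (by simp)).clm_apply contDiffOn_const

theorem pd_congr (h : Set.EqOn f g Ω) (I : Idx d) : Set.EqOn (pd I f) (pd I g) Ω := fun z hz => by
  have hfg : f =ᶠ[nhds z] g := Filter.eventuallyEq_of_mem (Ω.isOpen.mem_nhds hz) h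
  simp only [pd, hfg.fderiv_eq]

theorem pd_add (hf : DifferentiableAt ℝ f z) (hg : DifferentiableAt ℝ g z) (I : Idx d) :
    pd I (fun z => f z + g z) z = pd I f z + pd I g z := by
  simp only [pd, fderiv_fun_add hf hg, add_apply]

theorem pd_sub (hf : DifferentiableAt ℝ f z) (hg : DifferentiableAt ℝ g z) (I : Idx d) :
    pd I (fun z => f z - g z) z = pd I f z - pd I g z := by
  simp only [pd, fderiv_fun_sub hf hg, sub_apply]

theorem pd_mul (hf : DifferentiableAt ℝ f z) (hg : DifferentiableAt ℝ g z) (I : Idx d) :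
    pd I (fun z => f z * g z) z = pd I f z * g z + f z * pd I g z := by
  simp only [pd, fderiv_fun_mul hf hg, add_apply, smul_apply, smul_eq_mul]
  ring

theorem pd_sum {ι : Type*} (s : Finset ι) {F : ι → Coord d → ℝ}
    (hF : ∀ i ∈ s, DifferentiableAt ℝ (F i) z) (I : Idx d) :
    pd I (fun z => ∑ i ∈ s, F i z) z = ∑ i ∈ s, pd I (F i) z := by
  simp only [pd, fderiv_fun_sum hF, sum_apply]

theorem pd_sum_mul {ι : Type*} (s : Finset ι) {F H : ι → Coord d → ℝ}
    (hF : ∀ i ∈ s, DifferentiableAt ℝ (F i) z) (hH : ∀ i ∈ s, DifferentiableAt ℝ (H i) z)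
    (I : Idx d) : pd I (fun z => ∑ i ∈ s, F i z * H i z) z =
      ∑ i ∈ s, (pd I (F i) z * H i z + F i z * pd I (H i) z) :=
  (pd_sum s (fun i hi => (hF i hi).fun_mul (hH i hi)) I).trans
    (Finset.sum_congr rfl fun i hi => pd_mul (hF i hi) (hH i hi) I)

theorem pd_const (c : ℝ) (I : Idx d) : pd I (fun _ : Coord d => c) z = 0 := by
  simp [pd]

theorem pd_const_mul (hf : DifferentiableAt ℝ f z) (c : ℝ) (I : Idx d) :
    pd I (fun z => c * f z) z = c * pd I f z := by
  rw [pd_mul (differentiableAt_const c) hf, pd_const, zero_mul, zero_add]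

theorem pd_fst (I : Idx d) : pd I (fun z : Coord d => z.1) z = (stdVec I).1 := by
  rw [pd, fderiv_fst]
  rfl

theorem pd_rho (I : Idx d) : pd I (fun z : Coord d => z.2.2) z = (stdVec I).2.2 := by
  rw [pd, fderiv.snd differentiableAt_snd, fderiv_snd]
  rfl

theorem contDiffOn_rho : ContDiffOn ℝ ∞ (fun z : Coord d => z.2.2) Ω :=
  (contDiff_snd.comp contDiff_snd).contDiffOn

theorem pd_comm (hf : ContDiffOn ℝ ∞ f Ω) (hz : z ∈ Ω) (I J : Idx d) :
    pd I (pd J f) z = pd J (pd I f) z := by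
  have hsymm : IsSymmSndFDerivAt ℝ f z :=
    (hf.contDiffAt (Ω.isOpen.mem_nhds hz)).isSymmSndFDerivAt
      (by simpa using (WithTop.coe_le_coe.2 le_top : ((2 : ℕ∞) : WithTop ℕ∞) ≤ ∞))
  have hdiff : DifferentiableAt ℝ (fderiv ℝ f) z :=
    ((hf.fderiv_of_isOpen Ω.isOpen (m := ∞) (by simp)).contDiffAt
      (Ω.isOpen.mem_nhds hz)).differentiableAt (by simp)
  have pd_pd (I J : Idx d) :
      pd I (pd J f) z = fderiv ℝ (fderiv ℝ f) z (stdVec I) (stdVec J) := by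
    change fderiv ℝ (fun y => fderiv ℝ f y (stdVec J)) z (stdVec I) = _
    simp [fderiv_clm_apply hdiff (differentiableAt_const _)]
  rw [pd_pd, pd_pd, hsymm.eq]

theorem coord_eq_sum_stdVec (v : Coord d) :
    v = v.1 • stdVec (Sum.inl ()) + (∑ i, v.2.1 i • stdVec (Sum.inr (Sum.inl i))) +
      v.2.2 • stdVec (idxInf d) := by
  refine Prod.ext ?_ (Prod.ext ?_ ?_)
  · simp [Prod.fst_sum, stdVec]
  · ext j
    simp [Prod.fst_sum, Prod.snd_sum, stdVec, Finset.sum_apply, Pi.single_apply]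
  · simp [Prod.snd_sum, stdVec]

theorem fderiv_apply_eq_sum_pd (v : Coord d) :
    fderiv ℝ f z v = v.1 * pd (Sum.inl ()) f z + (∑ i, v.2.1 i * pd (Sum.inr (Sum.inl i)) f z) +
      v.2.2 * pd (idxInf d) f z := by
  conv_lhs => rw [coord_eq_sum_stdVec v]
  simp [pd]

theorem iteratedFDeriv_fderiv_apply (hf : ContDiffOn ℝ ∞ f Ω) (hz : z ∈ Ω)
    (k : ℕ) (v : Coord d) (w : Fin k → Coord d) :
    iteratedFDeriv ℝ k (fun y => fderiv ℝ f y v) z w =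
      iteratedFDeriv ℝ (k + 1) f z (Fin.snoc w v) := by
  have hfderiv : ContDiffAt ℝ ∞ (fun y => fderiv ℝ f y) z :=
    (hf.fderiv_of_isOpen Ω.isOpen (m := ∞) (by simp)).contDiffAt (Ω.isOpen.mem_nhds hz)
  have hcomp := (ContinuousLinearMap.apply ℝ ℝ v).iteratedFDeriv_comp_left hfderiv (i := k)
    (by exact_mod_cast le_top)
  rw [iteratedFDeriv_succ_apply_right]
  simpa [Function.comp_def] using congrArg (fun m => m w) hcomp

end PartialDerivatives

/-! ### Functions of order `O(ρ^m)` -/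

/-- The functions of order `O(ρ^m)` at `ρ = 0`, encoded recursively: `f` is smooth on `Ω`, and
`∂_ρ^k f = 0` on `Ω ∩ {ρ = 0}` for all `k < m`. -/
def IsORho {d : ℕ} (Ω : Opens (Coord d)) : ℕ → (Coord d → ℝ) → Prop
  | 0, f => ContDiffOn ℝ ∞ f Ω
  | m + 1, f =>
    ContDiffOn ℝ ∞ f Ω ∧ (∀ z ∈ Ω, z.2.2 = 0 → f z = 0) ∧ IsORho Ω m (pd (idxInf d) f)

namespace IsORho

variable {d : ℕ} {Ω : Opens (Coord d)} {f g : Coord d → ℝ} {m n : ℕ}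

theorem contDiffOn : ∀ {m : ℕ}, IsORho Ω m f → ContDiffOn ℝ ∞ f Ω
  | 0, h => h
  | _ + 1, h => h.1

theorem congr (hf : IsORho Ω m f) (h : Set.EqOn g f Ω) : IsORho Ω m g := by
  induction m generalizing f g with
  | zero => exact ContDiffOn.congr hf h
  | succ m ih =>
    exact ⟨hf.1.congr h, fun z hz h0 => (h hz).trans (hf.2.1 z hz h0), ih hf.2.2 (pd_congr h _)⟩

theorem of_succ (hf : IsORho Ω (m + 1) f) : IsORho Ω m f := by
  induction m generalizing f with
  | zero => exact hf.1
  | succ m ih => exact ⟨hf.1, hf.2.1, ih hf.2.2⟩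

theorem mono (hf : IsORho Ω m f) (h : n ≤ m) : IsORho Ω n f := by
  induction h with
  | refl => exact hf
  | step _ ih => exact ih hf.of_succ

theorem add (hf : IsORho Ω m f) (hg : IsORho Ω m g) : IsORho Ω m (fun z => f z + g z) := by
  induction m generalizing f g with
  | zero => exact ContDiffOn.add hf hg
  | succ m ih =>
    refine ⟨hf.1.add hg.1, fun z hz h0 => ?_, (ih hf.2.2 hg.2.2).congr fun z hz => ?_⟩
    · simp [hf.2.1 z hz h0, hg.2.1 z hz h0]
    · exact pd_add (differentiableAt_of_contDiffOn hf.1 hz) (differentiableAt_of_contDiffOn hg.1 hz)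
        _

theorem zero : IsORho Ω m (fun _ => 0) := by
  induction m with
  | zero => exact contDiffOn_const
  | succ m ih => exact ⟨contDiffOn_const, fun _ _ _ => rfl, ih.congr fun z _ => pd_const 0 _⟩

theorem sum {ι : Type*} (s : Finset ι) {F : ι → Coord d → ℝ}
    (hF : ∀ i ∈ s, IsORho Ω m (F i)) : IsORho Ω m (fun z => ∑ i ∈ s, F i z) := by
  classical
  induction s using Finset.induction_on with
  | empty => simpa using zero
  | insert i s hi ih =>
    simp only [Finset.sum_insert hi]
    exact (hF i (Finset.mem_insert_self i s)).add
      (ih fun j hj => hF j (Finset.mem_insert_of_mem hj))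

theorem mul (hf : IsORho Ω m f) (hg : IsORho Ω n g) :
    IsORho Ω (m + n) (fun z => f z * g z) := by
  obtain ⟨k, hk⟩ : ∃ k, m + n = k := ⟨_, rfl⟩
  rw [hk]
  induction k generalizing m n f g with
  | zero => exact hf.contDiffOn.mul hg.contDiffOn
  | succ k ih =>
    have leibniz : Set.EqOn (pd (idxInf d) fun z => f z * g z)
        (fun z => pd (idxInf d) f z * g z + f z * pd (idxInf d) g z) Ω := fun z hz =>
      pd_mul (differentiableAt_of_contDiffOn hf.contDiffOn hz)
        (differentiableAt_of_contDiffOn hg.contDiffOn hz) _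
    refine ⟨hf.contDiffOn.mul hg.contDiffOn, fun z hz h0 => ?_, (add ?_ ?_).congr leibniz⟩
    · rcases m with _ | m
      · obtain ⟨n, rfl⟩ : ∃ n', n = n' + 1 := ⟨k, by omega⟩
        simp [hg.2.1 z hz h0]
      · simp [hf.2.1 z hz h0]
    · rcases m with _ | m
      · exact ih (m := 0) (n := k) (contDiffOn_pd hf _) (hg.mono (by omega)) (by omega)
      · exact ih hf.2.2 hg (by omega)
    · rcases n with _ | n
      · exact ih (m := k) (n := 0) (hf.mono (by omega)) (contDiffOn_pd hg _) (by omega)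
      · exact ih hf hg.2.2 (by omega)

theorem smooth_mul (hf : ContDiffOn ℝ ∞ f Ω) (hg : IsORho Ω m g) :
    IsORho Ω m (fun z => f z * g z) :=
  (mul (m := 0) hf hg).mono (by omega)

theorem const_mul (c : ℝ) (hg : IsORho Ω m g) : IsORho Ω m (fun z => c * g z) :=
  hg.smooth_mul contDiffOn_const

theorem sub (hf : IsORho Ω m f) (hg : IsORho Ω m g) : IsORho Ω m (fun z => f z - g z) :=
  (hf.add (hg.const_mul (-1))).congr fun _ _ => by ring

theorem of_const_mul {c : ℝ} (hc : c ≠ 0) (h : IsORho Ω m (fun z => c * f z)) : IsORho Ω m f :=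
  (h.const_mul c⁻¹).congr fun z _ => by field_simp

theorem rho : IsORho Ω 1 (fun z => z.2.2) :=
  ⟨contDiffOn_rho, fun _ _ h => h, contDiffOn_pd contDiffOn_rho _⟩

theorem euler (hf : IsORho Ω m f) :
    IsORho Ω (m + 1) (fun z => z.2.2 * pd (idxInf d) f z - m * f z) := by
  induction m generalizing f with
  | zero => exact (rho.mul (n := 0) (contDiffOn_pd hf (idxInf d))).congr fun z _ => by simp
  | succ m ih =>
    have hpd := contDiffOn_pd hf.1 (idxInf d)
    have hleft : ContDiffOn ℝ ∞ (fun z => z.2.2 * pd (idxInf d) f z) Ω := contDiffOn_rho.mul hpd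
    have hright : ContDiffOn ℝ ∞ (fun z => ((m + 1 : ℕ) : ℝ) * f z) Ω := contDiffOn_const.mul hf.1
    refine ⟨hleft.sub hright, fun z hz h0 => by simp [h0, hf.2.1 z hz h0],
      (ih hf.2.2).congr fun z hz => ?_⟩
    rw [pd_sub (differentiableAt_of_contDiffOn hleft hz) (differentiableAt_of_contDiffOn hright hz),
      pd_mul (differentiableAt_of_contDiffOn contDiffOn_rho hz)
        (differentiableAt_of_contDiffOn hpd hz),
      pd_const_mul (differentiableAt_of_contDiffOn hf.1 hz), pd_rho]
    simp only [stdVec]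
    push_cast
    ring

theorem pd_tangential (hf : IsORho Ω m f) {I : Idx d} (hI : (stdVec I).2.2 = 0) :
    IsORho Ω m (pd I f) := by
  induction m generalizing f with
  | zero => exact contDiffOn_pd hf I
  | succ m ih =>
    refine ⟨contDiffOn_pd hf.1 I, fun z hz h0 => ?_,
      (ih hf.2.2).congr fun z hz => pd_comm hf.1 hz _ _⟩
    have hline : HasDerivAt (fun s : ℝ => f (z + s • stdVec I)) (pd I f z) 0 :=
      (differentiableAt_of_contDiffOn hf.1 hz).hasFDerivAt.hasLineDerivAt (stdVec I)
    have hmem : ∀ᶠ s : ℝ in nhds 0, z + s • stdVec I ∈ Ω := by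
      have hcont : ContinuousAt (fun s : ℝ => z + s • stdVec I) 0 := by fun_prop
      exact hcont (Ω.isOpen.mem_nhds (by simpa using hz))
    have hzero : (fun s : ℝ => f (z + s • stdVec I)) =ᶠ[nhds 0] fun _ => 0 :=
      hmem.mono fun s hs => hf.2.1 _ hs (by simp [h0, hI])
    exact (hline.congr_of_eventuallyEq hzero.symm).unique (hasDerivAt_const _ _)

theorem pd (hf : IsORho Ω (m + 1) f) (I : Idx d) : IsORho Ω m (pd I f) := by
  rcases I with _ | i | _
  · exact (hf.pd_tangential rfl).of_succ
  · exact (hf.pd_tangential rfl).of_succ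
  · exact hf.2.2

theorem fderiv_apply (hf : IsORho Ω (m + 1) f) (v : Coord d) :
    IsORho Ω m (fun z => fderiv ℝ f z v) := by
  refine IsORho.congr ?_ fun z _ => fderiv_apply_eq_sum_pd v
  exact (((hf.pd _).const_mul _).add (sum _ fun i _ => (hf.pd _).const_mul _)).add
    ((hf.pd _).const_mul _)

theorem iteratedFDeriv_eq_zero {k : ℕ} (hf : IsORho Ω (k + 1) f) {z : Coord d}
    (hz : z ∈ Ω) (h0 : z.2.2 = 0) : iteratedFDeriv ℝ k f z = 0 := by
  induction k generalizing f with
  | zero => ext w; simpa using hf.2.1 z hz h0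
  | succ k ih =>
    ext w
    rw [← Fin.snoc_init_self w, ← iteratedFDeriv_fderiv_apply hf.1 hz, ih (hf.fderiv_apply _)]
    simp

theorem of_iteratedFDeriv (hf : ContDiffOn ℝ ∞ f Ω)
    (h : ∀ k < m, ∀ z ∈ Ω, z.2.2 = 0 → iteratedFDeriv ℝ k f z = 0) : IsORho Ω m f := by
  induction m generalizing f with
  | zero => exact hf
  | succ m ih =>
    refine ⟨hf, fun z hz h0 => ?_, ih (contDiffOn_pd hf _) fun k hk z hz h0 => ?_⟩
    · simpa using congrArg (fun w => w 0) (h 0 (by omega) z hz h0)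
    · ext w
      exact (iteratedFDeriv_fderiv_apply hf hz k (stdVec (idxInf d)) w).trans
        (by rw [h (k + 1) (by omega) z hz h0]; rfl)

end IsORho

/-! ### Smooth metrics in coordinates -/

section Metrics

variable {d : ℕ}

/-- The matrix of the values at `z` of the components `A_{IJ}` (or `A^{IJ}`, or `A^I_J`). -/
abbrev compMatrix (A : Idx d → Idx d → Coord d → ℝ) (z : Coord d) : Matrix (Idx d) (Idx d) ℝ :=
  Matrix.of fun I J => A I J z

/-- The components `g^{IJ}` of the inverse of the metric with components `G`. -/
def ginv (G : Idx d → Idx d → Coord d → ℝ) (I J : Idx d) (z : Coord d) : ℝ :=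
  (compMatrix G z)⁻¹ I J

/-- `G_{IJ}` are the components of a smooth pseudo-Riemannian metric on `Ω`. -/
structure IsMetricOn (Ω : Opens (Coord d)) (G : Idx d → Idx d → Coord d → ℝ) : Prop where
  contDiffOn : ∀ I J, ContDiffOn ℝ ∞ (G I J) Ω
  symm : ∀ I J, Set.EqOn (G I J) (G J I) Ω
  det_ne_zero : ∀ z ∈ Ω, (compMatrix G z).det ≠ 0

/-- The components `∇_J T^K` of the covariant derivative of the vector field with components
`T`. -/
def nabla (G : Idx d → Idx d → Coord d → ℝ) (T : Idx d → Coord d → ℝ) (J K : Idx d)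
    (z : Coord d) : ℝ :=
  pd J (T K) z + ∑ I, christoffel G K J I z * T I z

/-- The tensor `A_J^K = g^{KM} A_{JM}`. -/
def raiseSnd (G A : Idx d → Idx d → Coord d → ℝ) (J K : Idx d) (z : Coord d) : ℝ :=
  ∑ M, ginv G K M z * A J M z

/-- The tensor `A^{IK} = g^{IJ} g^{KM} A_{JM}`. -/
def raiseBoth (G A : Idx d → Idx d → Coord d → ℝ) (I K : Idx d) (z : Coord d) : ℝ :=
  ∑ J, ginv G I J z * raiseSnd G A J K z

theorem contDiffOn_det {ι : Type*} [Fintype ι] [DecidableEq ι] {E : Type*} [NormedAddCommGroup E]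
    [NormedSpace ℝ E] {s : Set E} {A : ι → ι → E → ℝ} (hA : ∀ i j, ContDiffOn ℝ ∞ (A i j) s) :
    ContDiffOn ℝ ∞ (fun z => (Matrix.of fun i j => A i j z).det) s := by
  simp only [Matrix.det_apply', Matrix.of_apply]
  exact ContDiffOn.sum fun σ _ => contDiffOn_const.mul (contDiffOn_prod fun i _ => hA _ _)

theorem sum_sum_mul_eq_zero_of_symm_of_antisymm {ι : Type*} [Fintype ι] {s a : ι → ι → ℝ}
    (hs : ∀ i j, s i j = s j i) (ha : ∀ i j, a i j = -a j i) : ∑ i, ∑ j, s i j * a i j = 0 := by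
  have hneg : ∑ i, ∑ j, s i j * a i j = -∑ i, ∑ j, s i j * a i j := by
    conv_lhs => rw [Finset.sum_comm]
    simp only [← Finset.sum_neg_distrib]
    refine Finset.sum_congr rfl fun i _ => Finset.sum_congr rfl fun j _ => ?_
    rw [hs j i, ha j i, mul_neg]
  linarith

theorem raiseBoth_antisymm {A : Idx d → Idx d → Coord d → ℝ}
    (G : Idx d → Idx d → Coord d → ℝ) {z : Coord d} (hA : ∀ J M, A J M z = -A M J z)
    (I K : Idx d) : raiseBoth G A I K z = -raiseBoth G A K I z := by
  simp only [raiseBoth, raiseSnd, Finset.mul_sum, ← Finset.sum_neg_distrib]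
  rw [Finset.sum_comm]
  refine Finset.sum_congr rfl fun M _ => Finset.sum_congr rfl fun J _ => ?_
  rw [hA J M]
  ring

namespace IsMetricOn

variable {Ω : Opens (Coord d)} {G A : Idx d → Idx d → Coord d → ℝ} {z : Coord d}

theorem contDiffOn_ginv (h : IsMetricOn Ω G) (I J : Idx d) : ContDiffOn ℝ ∞ (ginv G I J) Ω := by
  have hadjugate : ContDiffOn ℝ ∞ (fun z => (compMatrix G z).adjugate I J) Ω := by
    simp only [Matrix.adjugate_apply]
    refine contDiffOn_det (A := fun K L z => (compMatrix G z).updateRow J (Pi.single I 1) K L)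
      fun K L => ?_
    by_cases hK : K = J
    · subst hK
      simpa using contDiffOn_const
    · simpa [Matrix.updateRow_apply, hK] using h.contDiffOn K L
  refine (((contDiffOn_det h.contDiffOn).inv h.det_ne_zero).mul hadjugate).congr fun z _ => ?_
  simp only [ginv, Matrix.inv_def, Ring.inverse_eq_inv', Matrix.smul_apply, smul_eq_mul,
    Pi.inv_apply]

theorem contDiffOn_raiseSnd (h : IsMetricOn Ω G) (hA : ∀ J M, ContDiffOn ℝ ∞ (A J M) Ω)
    (J K : Idx d) : ContDiffOn ℝ ∞ (raiseSnd G A J K) Ω :=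
  ContDiffOn.sum fun M _ => (h.contDiffOn_ginv K M).mul (hA J M)

theorem contDiffOn_raiseBoth (h : IsMetricOn Ω G) (hA : ∀ J M, ContDiffOn ℝ ∞ (A J M) Ω)
    (I K : Idx d) : ContDiffOn ℝ ∞ (raiseBoth G A I K) Ω :=
  ContDiffOn.sum fun J _ => (h.contDiffOn_ginv I J).mul (h.contDiffOn_raiseSnd hA J K)

theorem contDiffOn_christoffel (h : IsMetricOn Ω G) (K I J : Idx d) :
    ContDiffOn ℝ ∞ (christoffel G K I J) Ω := by
  have hpd (I J L : Idx d) : ContDiffOn ℝ ∞ (pd I (G J L)) Ω := contDiffOn_pd (h.contDiffOn J L) I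
  exact contDiffOn_const.mul (ContDiffOn.sum fun L _ =>
    (h.contDiffOn_ginv K L).mul (((hpd _ _ _).add (hpd _ _ _)).sub (hpd _ _ _)))

theorem contDiffOn_ricci (h : IsMetricOn Ω G) (I J : Idx d) :
    ContDiffOn ℝ ∞ (ricci G I J) Ω := by
  have hΓ := h.contDiffOn_christoffel
  exact (ContDiffOn.sum fun K _ => (contDiffOn_pd (hΓ _ _ _) _).sub
    (contDiffOn_pd (hΓ _ _ _) _)).add
    (ContDiffOn.sum fun K _ => ContDiffOn.sum fun L _ =>
      ((hΓ _ _ _).mul (hΓ _ _ _)).sub ((hΓ _ _ _).mul (hΓ _ _ _)))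

theorem christoffel_symm (h : IsMetricOn Ω G) (hz : z ∈ Ω) (K I J : Idx d) :
    christoffel G K I J z = christoffel G K J I z := by
  simp only [christoffel, pd_congr (h.symm I J) _ hz, add_comm (pd I _ z)]

theorem ginv_mul (h : IsMetricOn Ω G) (hz : z ∈ Ω) : compMatrix (ginv G) z * compMatrix G z = 1 :=
  Matrix.nonsing_inv_mul _ (isUnit_iff_ne_zero.2 (h.det_ne_zero z hz))

theorem mul_ginv (h : IsMetricOn Ω G) (hz : z ∈ Ω) : compMatrix G z * compMatrix (ginv G) z = 1 :=
  Matrix.mul_nonsing_inv _ (isUnit_iff_ne_zero.2 (h.det_ne_zero z hz))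

theorem sum_ginv_mul (h : IsMetricOn Ω G) (hz : z ∈ Ω) (I J : Idx d) :
    ∑ K, ginv G I K z * G K J z = (1 : Matrix (Idx d) (Idx d) ℝ) I J := by
  simpa only [Matrix.mul_apply, Matrix.of_apply] using congrFun₂ (h.ginv_mul hz) I J

theorem sum_mul_ginv (h : IsMetricOn Ω G) (hz : z ∈ Ω) (I J : Idx d) :
    ∑ K, G I K z * ginv G K J z = (1 : Matrix (Idx d) (Idx d) ℝ) I J := by
  simpa only [Matrix.mul_apply, Matrix.of_apply] using congrFun₂ (h.mul_ginv hz) I J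

theorem ginv_symm (h : IsMetricOn Ω G) (hz : z ∈ Ω) (I J : Idx d) :
    ginv G I J z = ginv G J I z := by
  have htranspose : (compMatrix G z).transpose = compMatrix G z := by
    ext I J
    exact h.symm J I hz
  have hinv := Matrix.transpose_nonsing_inv (compMatrix G z)
  rw [htranspose] at hinv
  exact congrFun₂ hinv J I

theorem sum_mul_christoffel (h : IsMetricOn Ω G) (hz : z ∈ Ω) (L I J : Idx d) :
    ∑ K, G L K z * christoffel G K I J z =
      (1 / 2) * (pd I (G J L) z + pd J (G I L) z - pd L (G I J) z) := by
  let γ : Idx d → ℝ := fun L => (1 / 2) * (pd I (G J L) z + pd J (G I L) z - pd L (G I J) z)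
  have hΓ : (fun K => christoffel G K I J z) = (compMatrix (ginv G) z).mulVec γ := by
    ext K
    simp only [christoffel, Matrix.mulVec, dotProduct, Finset.mul_sum, γ, Matrix.of_apply, ginv]
    exact Finset.sum_congr rfl fun _ _ => by ring
  change (compMatrix G z).mulVec (fun K => christoffel G K I J z) L = γ L
  rw [hΓ, Matrix.mulVec_mulVec, h.mul_ginv hz, Matrix.one_mulVec]

theorem pd_eq_sum_mul_christoffel (h : IsMetricOn Ω G) (hz : z ∈ Ω) (K I J : Idx d) :
    pd K (G I J) z =
      ∑ L, G I L z * christoffel G L K J z + ∑ L, christoffel G L K I z * G L J z := by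
  have hcomm : ∑ L, christoffel G L K I z * G L J z = ∑ L, G J L z * christoffel G L K I z :=
    Finset.sum_congr rfl fun L _ => by rw [h.symm L J hz, mul_comm]
  rw [hcomm, h.sum_mul_christoffel hz, h.sum_mul_christoffel hz, pd_congr (h.symm J I) K hz,
    pd_congr (h.symm K J) I hz, pd_congr (h.symm K I) J hz]
  ring

theorem pd_ginv (h : IsMetricOn Ω G) (hz : z ∈ Ω) (K : Idx d) :
    compMatrix (fun I J => pd K (ginv G I J)) z =
      -(compMatrix (ginv G) z * compMatrix (fun I J => pd K (G I J)) z *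
        compMatrix (ginv G) z) := by
  have hginv (I J : Idx d) := differentiableAt_of_contDiffOn (h.contDiffOn_ginv I J) hz
  have hG (I J : Idx d) := differentiableAt_of_contDiffOn (h.contDiffOn I J) hz
  have leibniz : compMatrix (fun I J => pd K (ginv G I J)) z * compMatrix G z +
      compMatrix (ginv G) z * compMatrix (fun I J => pd K (G I J)) z = 0 := by
    ext I J
    simp only [Matrix.add_apply, Matrix.mul_apply, Matrix.of_apply, Matrix.zero_apply]
    rw [← Finset.sum_add_distrib, ← pd_const (z := z) ((1 : Matrix (Idx d) (Idx d) ℝ) I J) K,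
      ← pd_congr (fun z hz => h.sum_ginv_mul hz I J) K hz,
      pd_sum_mul _ (fun M _ => hginv I M) (fun M _ => hG M J)]
  rw [← neg_mul, ← eq_neg_of_add_eq_zero_left leibniz, Matrix.mul_assoc, h.mul_ginv hz,
    Matrix.mul_one]

theorem pd_ginv_eq_sum_christoffel_mul (h : IsMetricOn Ω G) (hz : z ∈ Ω) (K I J : Idx d) :
    pd K (ginv G I J) z = -∑ L, christoffel G I K L z * ginv G L J z -
      ∑ L, christoffel G J K L z * ginv G I L z := by
  set H := compMatrix (ginv G) z
  set C : Matrix (Idx d) (Idx d) ℝ := Matrix.of fun L M => christoffel G L K M z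
  have hcompat : compMatrix (fun I J => pd K (G I J)) z =
      compMatrix G z * C + C.transpose * compMatrix G z := by
    ext I J
    simpa [Matrix.mul_apply, C] using h.pd_eq_sum_mul_christoffel hz K I J
  have hpd : compMatrix (fun I J => pd K (ginv G I J)) z = -(C * H) - H * C.transpose := by
    rw [h.pd_ginv hz, hcompat, Matrix.mul_add, Matrix.add_mul, ← Matrix.mul_assoc, h.ginv_mul hz,
      Matrix.one_mul, Matrix.mul_assoc, Matrix.mul_assoc, h.mul_ginv hz, Matrix.mul_one, neg_add']
  have hentry := congrFun₂ hpd I J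
  simp only [Matrix.of_apply, Matrix.sub_apply, Matrix.neg_apply, Matrix.mul_apply,
    Matrix.transpose_apply, C, H] at hentry
  simpa only [mul_comm] using hentry

end IsMetricOn

end Metrics

section RicciIdentity

namespace IsMetricOn

variable {d : ℕ} {Ω : Opens (Coord d)} {G φ : Idx d → Idx d → Coord d → ℝ} {T : Idx d → Coord d → ℝ}
  {z : Coord d}

theorem pd_nabla (h : IsMetricOn Ω G) (hT : ∀ K, ContDiffOn ℝ ∞ (T K) Ω) (hz : z ∈ Ω)
    (I J K : Idx d) :
    pd I (nabla G T J K) z = pd I (pd J (T K)) z + ∑ L, (pd I (christoffel G K L J) z * T L z +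
      christoffel G K L J z * pd I (T L) z) := by
  have hΓ (L : Idx d) := differentiableAt_of_contDiffOn (h.contDiffOn_christoffel K J L) hz
  have hTz (L : Idx d) := differentiableAt_of_contDiffOn (hT L) hz
  change pd I (fun z => pd J (T K) z + ∑ L, christoffel G K J L z * T L z) z = _
  rw [pd_add (differentiableAt_of_contDiffOn (contDiffOn_pd (hT K) J) hz)
    (DifferentiableAt.fun_sum fun L _ => (hΓ L).fun_mul (hTz L)),
    pd_sum_mul _ (fun L _ => hΓ L) (fun L _ => hTz L)]
  have hsymm (L : Idx d) : pd I (christoffel G K J L) z = pd I (christoffel G K L J) z :=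
    pd_congr (fun z hz => h.christoffel_symm hz K J L) I hz
  simp only [h.christoffel_symm hz K J, hsymm]

theorem sum_mul_ricci (h : IsMetricOn Ω G) (hT : ∀ K, ContDiffOn ℝ ∞ (T K) Ω) (hz : z ∈ Ω)
    (J : Idx d) :
    ∑ I, T I z * ricci G I J z =
      ∑ K, (pd K (nabla G T J K) z - pd J (nabla G T K K) z) +
        ∑ K, ∑ L, (christoffel G K K L z * nabla G T J L z -
          christoffel G K J L z * nabla G T K L z) := by
  let Γ := fun K I J => christoffel G K I J z
  have hpd (K : Idx d) : pd K (nabla G T J K) z - pd J (nabla G T K K) z =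
      ∑ I, T I z * (pd K (christoffel G K I J) z - pd J (christoffel G K I K) z) +
        ∑ L, (Γ K J L * pd K (T L) z - Γ K K L * pd J (T L) z) := by
    rw [h.pd_nabla hT hz, h.pd_nabla hT hz, pd_comm (hT K) hz K J, add_sub_add_left_eq_sub,
      ← Finset.sum_sub_distrib, ← Finset.sum_add_distrib]
    refine Finset.sum_congr rfl fun L _ => ?_
    simp only [Γ, h.christoffel_symm hz K J L, h.christoffel_symm hz K K L]
    ring
  have hquad (K L : Idx d) : Γ K K L * nabla G T J L z - Γ K J L * nabla G T K L z =
      ∑ I, T I z * (Γ K K L * Γ L I J - Γ K J L * Γ L I K) -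
        (Γ K J L * pd K (T L) z - Γ K K L * pd J (T L) z) := by
    have hdistrib : ∑ I, T I z * (Γ K K L * Γ L I J - Γ K J L * Γ L I K) =
        Γ K K L * ∑ I, Γ L J I * T I z - Γ K J L * ∑ I, Γ L K I * T I z := by
      rw [Finset.mul_sum, Finset.mul_sum, ← Finset.sum_sub_distrib]
      refine Finset.sum_congr rfl fun I _ => ?_
      simp only [Γ, h.christoffel_symm hz L I J, h.christoffel_symm hz L I K]
      ring
    rw [hdistrib]
    simp only [nabla, Γ]
    ring
  have hswap : ∑ I, T I z * ricci G I J z =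
      ∑ K, ∑ I, T I z * (pd K (christoffel G K I J) z - pd J (christoffel G K I K) z) +
        ∑ K, ∑ L, ∑ I, T I z * (Γ K K L * Γ L I J - Γ K J L * Γ L I K) := by
    simp only [ricci, mul_add, Finset.mul_sum, Finset.sum_add_distrib]
    rw [Finset.sum_comm, Finset.sum_comm (f := fun I K => ∑ L, _)]
    exact congrArg _ (Finset.sum_congr rfl fun K _ => Finset.sum_comm)
  rw [hswap, Finset.sum_congr rfl fun K _ => hpd K,
    Finset.sum_congr rfl fun K _ => Finset.sum_congr rfl fun L _ => hquad K L]
  simp only [Finset.sum_add_distrib, Finset.sum_sub_distrib (f := fun _ => ∑ _, _)]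
  simp only [Finset.sum_sub_distrib]
  ring

theorem raiseSnd_trace (h : IsMetricOn Ω G) (hφ : ∀ J M, φ J M z = -φ M J z) (hz : z ∈ Ω) :
    ∑ K, raiseSnd G φ K K z = 0 :=
  sum_sum_mul_eq_zero_of_symm_of_antisymm (h.ginv_symm hz) hφ

theorem sum_mul_ricci_of_homothety (h : IsMetricOn Ω G) (hT : ∀ K, ContDiffOn ℝ ∞ (T K) Ω)
    (hφ : ∀ J M, ContDiffOn ℝ ∞ (φ J M) Ω) (hφ_antisymm : ∀ J M, ∀ z ∈ Ω, φ J M z = -φ M J z)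
    (hTφ : ∀ J K, ∀ z ∈ Ω,
      nabla G T J K z = (1 : Matrix (Idx d) (Idx d) ℝ) J K + raiseSnd G φ J K z)
    (hz : z ∈ Ω) (J : Idx d) :
    ∑ I, T I z * ricci G I J z = ∑ K, pd K (raiseSnd G φ J K) z +
      ∑ K, ∑ L, (christoffel G K K L z * raiseSnd G φ J L z -
        christoffel G K J L z * raiseSnd G φ K L z) := by
  have hdiff (J K : Idx d) := differentiableAt_of_contDiffOn (h.contDiffOn_raiseSnd hφ J K) hz
  have hpd (I J K : Idx d) : pd I (nabla G T J K) z = pd I (raiseSnd G φ J K) z := by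
    rw [pd_congr (hTφ J K) I hz, pd_add (differentiableAt_const _) (hdiff J K), pd_const, zero_add]
  have htrace : ∑ K, pd J (raiseSnd G φ K K) z = 0 := by
    rw [← pd_sum _ fun K _ => hdiff K K, pd_congr (g := fun _ => 0) (fun z hz =>
      h.raiseSnd_trace (fun J M => hφ_antisymm J M z hz) hz) J hz, pd_const]
  have hone : ∑ K, ∑ L, (christoffel G K K L z * (1 : Matrix (Idx d) (Idx d) ℝ) J L -
      christoffel G K J L z * (1 : Matrix (Idx d) (Idx d) ℝ) K L) = 0 := by
    simp [Matrix.one_apply, Finset.sum_sub_distrib, h.christoffel_symm hz _ J]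
  rw [h.sum_mul_ricci hT hz]
  simp only [hpd, hTφ _ _ z hz, Finset.sum_sub_distrib, htrace, mul_add, Finset.sum_add_distrib,
    sub_zero] at hone ⊢
  linear_combination hone

theorem sum_ginv_mul_pd_raiseSnd (h : IsMetricOn Ω G) (hφ : ∀ J M, ContDiffOn ℝ ∞ (φ J M) Ω)
    (hz : z ∈ Ω) (I K : Idx d) :
    ∑ J, ginv G I J z * pd K (raiseSnd G φ J K) z = pd K (raiseBoth G φ I K) z +
      ∑ L, christoffel G I K L z * raiseBoth G φ L K z +
      ∑ J, ∑ L, ginv G I L z * (christoffel G J L K z * raiseSnd G φ J K z) := by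
  have leibniz : pd K (raiseBoth G φ I K) z = ∑ J, (pd K (ginv G I J) z * raiseSnd G φ J K z +
      ginv G I J z * pd K (raiseSnd G φ J K) z) :=
    pd_sum_mul _ (fun J _ => differentiableAt_of_contDiffOn (h.contDiffOn_ginv I J) hz)
      (fun J _ => differentiableAt_of_contDiffOn (h.contDiffOn_raiseSnd hφ J K) hz) K
  have hginv : ∑ J, pd K (ginv G I J) z * raiseSnd G φ J K z =
      -∑ L, christoffel G I K L z * raiseBoth G φ L K z -
        ∑ J, ∑ L, ginv G I L z * (christoffel G J L K z * raiseSnd G φ J K z) := by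
    simp only [h.pd_ginv_eq_sum_christoffel_mul hz, raiseBoth, sub_mul, neg_mul,
      Finset.sum_mul, Finset.mul_sum, Finset.sum_sub_distrib, Finset.sum_neg_distrib]
    rw [Finset.sum_comm]
    simp only [h.christoffel_symm hz _ K, mul_assoc, mul_left_comm]
  rw [leibniz, Finset.sum_add_distrib, hginv]
  ring

/-- For a homothety `T` and `φ = dT♭ / 2` this is a Maxwell equation with source `Ric(T, ·)`: the
right-hand side is the divergence of the antisymmetric tensor `φ^{IK}`. -/
theorem sum_ginv_mul_sum_mul_ricci (h : IsMetricOn Ω G) (hT : ∀ K, ContDiffOn ℝ ∞ (T K) Ω)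
    (hφ : ∀ J M, ContDiffOn ℝ ∞ (φ J M) Ω) (hφ_antisymm : ∀ J M, ∀ z ∈ Ω, φ J M z = -φ M J z)
    (hTφ : ∀ J K, ∀ z ∈ Ω,
      nabla G T J K z = (1 : Matrix (Idx d) (Idx d) ℝ) J K + raiseSnd G φ J K z)
    (hz : z ∈ Ω) (I : Idx d) :
    ∑ J, ginv G I J z * ∑ L, T L z * ricci G L J z = ∑ K, pd K (raiseBoth G φ I K) z +
      ∑ K, (∑ L, christoffel G L L K z) * raiseBoth G φ I K z := by
  have hcancel : ∑ K, ∑ L, christoffel G I K L z * raiseBoth G φ L K z = 0 := by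
    exact sum_sum_mul_eq_zero_of_symm_of_antisymm (h.christoffel_symm hz I)
      fun K L => raiseBoth_antisymm G (fun J M => hφ_antisymm J M z hz) L K
  have hdiv : ∑ J, ginv G I J z * ∑ K, pd K (raiseSnd G φ J K) z =
      ∑ K, pd K (raiseBoth G φ I K) z +
        ∑ K, ∑ J, ∑ L, ginv G I L z * (christoffel G J L K z * raiseSnd G φ J K z) := by
    simp only [Finset.mul_sum]
    rw [Finset.sum_comm]
    simp only [h.sum_ginv_mul_pd_raiseSnd hφ hz, Finset.sum_add_distrib, hcancel, add_zero]
  have hquad : ∑ J, ginv G I J z * ∑ K, ∑ L, christoffel G K J L z * raiseSnd G φ K L z =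
      ∑ K, ∑ J, ∑ L, ginv G I L z * (christoffel G J L K z * raiseSnd G φ J K z) := by
    simp only [Finset.mul_sum]
    rw [Finset.sum_comm, Finset.sum_congr rfl fun K _ => Finset.sum_comm]
    exact Finset.sum_comm
  have htrace : ∑ J, ginv G I J z * ∑ K, ∑ L, christoffel G K K L z * raiseSnd G φ J L z =
      ∑ K, (∑ L, christoffel G L L K z) * raiseBoth G φ I K z := by
    simp only [raiseBoth, Finset.mul_sum, Finset.sum_mul]
    rw [Finset.sum_congr rfl fun J _ => Finset.sum_comm, Finset.sum_comm]
    refine Finset.sum_congr rfl fun K _ => Finset.sum_congr rfl fun J _ => ?_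
    exact Finset.sum_congr rfl fun L _ => by ring
  simp only [h.sum_mul_ricci_of_homothety hT hφ hφ_antisymm hTφ hz, Finset.sum_sub_distrib,
    mul_add, mul_sub, Finset.sum_add_distrib, hdiv, hquad, htrace]
  ring

end IsMetricOn

end RicciIdentity

/-! ### Metrics with a dilatation symmetry -/

section Homogeneous

variable {d : ℕ}

/-- The index `0` of the coordinate `t`. -/
abbrev idxZero (d : ℕ) : Idx d := Sum.inl ()

/-- The index of the coordinate `x^i`. -/
abbrev idxMid (i : Fin d) : Idx d := Sum.inr (Sum.inl i)

/-- The degree of the coordinate with index `I` under the dilatations `t ↦ s t`; it is also the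
`I`-th component of `∂_t`. -/
def wt (I : Idx d) : ℝ := (stdVec I).1

@[simp]
theorem wt_inl (u : Unit) : wt (Sum.inl u : Idx d) = 1 := rfl

@[simp]
theorem wt_inr (i : Fin d ⊕ Unit) : wt (Sum.inr i : Idx d) = 0 := by
  rcases i with _ | _ <;> rfl

theorem sum_idx {R : Type*} [AddCommMonoid R] (f : Idx d → R) :
    ∑ K, f K = f (idxZero d) + ((∑ i, f (idxMid i)) + f (idxInf d)) := by
  simp [Fintype.sum_sum_type]

theorem one_apply_idxZero (K : Idx d) : (1 : Matrix (Idx d) (Idx d) ℝ) K (idxZero d) = wt K := by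
  rcases K with _ | _ <;> simp

/-- Homogeneity of degree `c` in `t`, in the form of Euler's equation. -/
def IsHomogeneousOn (Ω : Opens (Coord d)) (c : ℝ) (f : Coord d → ℝ) : Prop :=
  ∀ z ∈ Ω, z.1 * pd (idxZero d) f z = c * f z

namespace IsHomogeneousOn

variable {Ω : Opens (Coord d)} {c c' : ℝ} {f g : Coord d → ℝ}

theorem fst : IsHomogeneousOn Ω 1 (fun z => z.1) := fun z _ => by
  rw [pd_fst, mul_comm, stdVec]

theorem mul (hf : IsHomogeneousOn Ω c f) (hg : IsHomogeneousOn Ω c' g)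
    (hf' : ContDiffOn ℝ ∞ f Ω) (hg' : ContDiffOn ℝ ∞ g Ω) :
    IsHomogeneousOn Ω (c + c') (fun z => f z * g z) := fun z hz => by
  rw [pd_mul (differentiableAt_of_contDiffOn hf' hz) (differentiableAt_of_contDiffOn hg' hz)]
  linear_combination g z * hf z hz + f z * hg z hz

theorem const_mul (hf : IsHomogeneousOn Ω c f) (hf' : ContDiffOn ℝ ∞ f Ω) (b : ℝ) :
    IsHomogeneousOn Ω c (fun z => b * f z) := fun z hz => by
  rw [pd_const_mul (differentiableAt_of_contDiffOn hf' hz)]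
  linear_combination b * hf z hz

theorem sub (hf : IsHomogeneousOn Ω c f) (hg : IsHomogeneousOn Ω c g)
    (hf' : ContDiffOn ℝ ∞ f Ω) (hg' : ContDiffOn ℝ ∞ g Ω) :
    IsHomogeneousOn Ω c (fun z => f z - g z) := fun z hz => by
  rw [pd_sub (differentiableAt_of_contDiffOn hf' hz) (differentiableAt_of_contDiffOn hg' hz)]
  linear_combination hf z hz - hg z hz

theorem sum {ι : Type*} (s : Finset ι) {F : ι → Coord d → ℝ}
    (hF : ∀ i ∈ s, IsHomogeneousOn Ω c (F i)) (hF' : ∀ i ∈ s, ContDiffOn ℝ ∞ (F i) Ω) :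
    IsHomogeneousOn Ω c (fun z => ∑ i ∈ s, F i z) := fun z hz => by
  rw [pd_sum s fun i hi => differentiableAt_of_contDiffOn (hF' i hi) hz, Finset.mul_sum,
    Finset.mul_sum]
  exact Finset.sum_congr rfl fun i hi => hF i hi z hz

theorem pd (hf : IsHomogeneousOn Ω c f) (hf' : ContDiffOn ℝ ∞ f Ω) (I : Idx d) :
    IsHomogeneousOn Ω (c - wt I) (pd I f) := fun z hz => by
  have hpd : WeylAmbient.pd I (fun z => z.1 * WeylAmbient.pd (idxZero d) f z) z =
      WeylAmbient.pd I (fun z => c * f z) z := pd_congr hf I hz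
  rw [pd_mul differentiableAt_fst (differentiableAt_of_contDiffOn (contDiffOn_pd hf' _) hz), pd_fst,
    pd_const_mul (differentiableAt_of_contDiffOn hf' hz), pd_comm hf' hz I] at hpd
  have hwt : wt I * WeylAmbient.pd (idxZero d) f z = wt I * WeylAmbient.pd I f z := by
    rcases I with _ | _ <;> simp
  rw [wt] at hwt ⊢
  linear_combination hpd - hwt

end IsHomogeneousOn

/-- A smooth metric that the dilatations `t ↦ s t` rescale by `s²`. -/
structure IsHomogeneousMetricOn (Ω : Opens (Coord d)) (G : Idx d → Idx d → Coord d → ℝ) : Prop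
    extends IsMetricOn Ω G where
  homogeneous : ∀ I J, IsHomogeneousOn Ω (2 - wt I - wt J) (G I J)

/-- The components of the generator `T = t ∂_t` of the dilatations. -/
def dilatation (I : Idx d) (z : Coord d) : ℝ := wt I * z.1

/-- Half the exterior derivative of the one-form `T♭ = t G_{0M} dz^M` dual to `T = t ∂_t`. -/
def dilatationCurl (G : Idx d → Idx d → Coord d → ℝ) (J M : Idx d) (z : Coord d) : ℝ :=
  (1 / 2) * (pd J (fun z => z.1 * G (idxZero d) M z) z - pd M (fun z => z.1 * G (idxZero d) J z) z)

theorem dilatationCurl_antisymm (G : Idx d → Idx d → Coord d → ℝ) (J M : Idx d) (z : Coord d) :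
    dilatationCurl G J M z = -dilatationCurl G M J z := by
  simp only [dilatationCurl]
  ring

theorem contDiffOn_dilatation {Ω : Opens (Coord d)} (I : Idx d) :
    ContDiffOn ℝ ∞ (dilatation I) Ω :=
  contDiffOn_const.mul contDiffOn_fst

theorem pd_dilatation (J K : Idx d) (z : Coord d) : pd J (dilatation K) z = wt K * wt J := by
  change pd J (fun z => wt K * z.1) z = _
  rw [pd_const_mul differentiableAt_fst, pd_fst, wt, wt]

theorem sum_mul_dilatation (f : Idx d → ℝ) (z : Coord d) :
    ∑ I, f I * dilatation I z = z.1 * f (idxZero d) := by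
  simp [dilatation, mul_comm]

theorem IsMetricOn.contDiffOn_dilatationCurl {Ω : Opens (Coord d)}
    {G : Idx d → Idx d → Coord d → ℝ} (h : IsMetricOn Ω G) (J M : Idx d) :
    ContDiffOn ℝ ∞ (dilatationCurl G J M) Ω :=
  contDiffOn_const.mul ((contDiffOn_pd (contDiffOn_fst.mul (h.contDiffOn _ _)) _).sub
    (contDiffOn_pd (contDiffOn_fst.mul (h.contDiffOn _ _)) _))

namespace IsHomogeneousMetricOn

variable {Ω : Opens (Coord d)} {G : Idx d → Idx d → Coord d → ℝ} {z : Coord d}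

theorem homogeneous_dilatationCurl (h : IsHomogeneousMetricOn Ω G) (J M : Idx d) :
    IsHomogeneousOn Ω (2 - wt J - wt M) (dilatationCurl G J M) := by
  have hsmooth (J : Idx d) : ContDiffOn ℝ ∞ (fun z => z.1 * G (idxZero d) J z) Ω :=
    contDiffOn_fst.mul (h.contDiffOn _ _)
  have hpd (J M : Idx d) :
      IsHomogeneousOn Ω (2 - wt J - wt M) (pd M fun z => z.1 * G (idxZero d) J z) := by
    have hmul := IsHomogeneousOn.fst.mul (h.homogeneous (idxZero d) J) contDiffOn_fst
      (h.contDiffOn _ _)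
    convert hmul.pd (hsmooth J) M using 1
    rw [wt_inl]
    ring
  have hcomm : 2 - wt J - wt M = 2 - wt M - wt J := by ring
  exact ((hcomm ▸ hpd M J).sub (hpd J M) (contDiffOn_pd (hsmooth M) J)
    (contDiffOn_pd (hsmooth J) M)).const_mul
    ((contDiffOn_pd (hsmooth M) J).sub (contDiffOn_pd (hsmooth J) M)) _

theorem homogeneous_ginv (h : IsHomogeneousMetricOn Ω G) (I J : Idx d) :
    IsHomogeneousOn Ω (wt I + wt J - 2) (ginv G I J) := fun z hz => by
  set H := compMatrix (ginv G) z
  let W : Matrix (Idx d) (Idx d) ℝ := Matrix.diagonal wt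
  have hG : z.1 • compMatrix (fun I J => pd (idxZero d) (G I J)) z =
      (2 : ℝ) • compMatrix G z - W * compMatrix G z - compMatrix G z * W := by
    ext I J
    simp only [Matrix.smul_apply, Matrix.of_apply, smul_eq_mul, h.homogeneous I J z hz,
      Matrix.sub_apply, W, Matrix.diagonal_mul, Matrix.mul_diagonal]
    ring
  have hH : z.1 • compMatrix (fun I J => pd (idxZero d) (ginv G I J)) z =
      W * H + H * W - (2 : ℝ) • H := by
    rw [h.pd_ginv hz, smul_neg, ← Matrix.smul_mul, ← Matrix.mul_smul, hG]
    simp only [Matrix.mul_sub, Matrix.sub_mul, Matrix.mul_smul, Matrix.smul_mul, h.ginv_mul hz,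
      ← Matrix.mul_assoc, Matrix.one_mul]
    simp only [Matrix.mul_assoc, h.mul_ginv hz, Matrix.mul_one, H]
    abel
  have hentry := congrFun₂ hH I J
  simp only [Matrix.smul_apply, Matrix.of_apply, smul_eq_mul, Matrix.sub_apply, Matrix.add_apply,
    W, Matrix.diagonal_mul, Matrix.mul_diagonal, H] at hentry
  linear_combination hentry

theorem homogeneous_raiseBoth (h : IsHomogeneousMetricOn Ω G)
    {A : Idx d → Idx d → Coord d → ℝ} (hA : ∀ J M, ContDiffOn ℝ ∞ (A J M) Ω)
    (hA_hom : ∀ J M, IsHomogeneousOn Ω (2 - wt J - wt M) (A J M)) (I K : Idx d) :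
    IsHomogeneousOn Ω (wt I + wt K - 2) (raiseBoth G A I K) := by
  have hraiseSnd (J : Idx d) : IsHomogeneousOn Ω (wt K - wt J) (raiseSnd G A J K) := by
    refine IsHomogeneousOn.sum _ (fun M _ => ?_) fun M _ => (h.contDiffOn_ginv K M).mul (hA J M)
    convert (h.homogeneous_ginv K M).mul (hA_hom J M) (h.contDiffOn_ginv K M) (hA J M) using 1
    ring
  refine IsHomogeneousOn.sum _ (fun J _ => ?_) fun J _ =>
    (h.contDiffOn_ginv I J).mul (h.contDiffOn_raiseSnd hA J K)
  convert (h.homogeneous_ginv I J).mul (hraiseSnd J) (h.contDiffOn_ginv I J)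
    (h.contDiffOn_raiseSnd hA J K) using 1
  ring

theorem dilatationCurl_eq (h : IsHomogeneousMetricOn Ω G) (hz : z ∈ Ω) (J M : Idx d) :
    dilatationCurl G J M z = (1 / 2) * (wt J * G (idxZero d) M z + z.1 * pd J (G (idxZero d) M) z
      - wt M * G (idxZero d) J z - z.1 * pd M (G (idxZero d) J) z) := by
  have hG (K : Idx d) := differentiableAt_of_contDiffOn (h.contDiffOn (idxZero d) K) hz
  simp only [dilatationCurl, pd_mul differentiableAt_fst (hG _), pd_fst, wt]
  ring

theorem dilatationCurl_eq_add_sub (h : IsHomogeneousMetricOn Ω G) (hz : z ∈ Ω) (J M : Idx d) :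
    dilatationCurl G J M z = z.1 * ((1 / 2) * (pd (idxZero d) (G J M) z
      + pd J (G (idxZero d) M) z - pd M (G (idxZero d) J) z)) + wt J * G M (idxZero d) z
      - G M J z := by
  have hwtJ : wt J * (G J M z - G (idxZero d) M z) = 0 := by
    rcases J with _ | _ <;> simp
  have hwtM : wt M * (G J M z - G (idxZero d) J z) = 0 := by
    rcases M with _ | _
    · simp [h.symm J (Sum.inl _) hz]
    · simp
  rw [h.dilatationCurl_eq hz, h.symm M J hz, h.symm M _ hz]
  linear_combination (-1 / 2) * h.homogeneous J M z hz + (1 / 2) * hwtJ + (1 / 2) * hwtM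

theorem nabla_dilatation (h : IsHomogeneousMetricOn Ω G) (hz : z ∈ Ω) (J K : Idx d) :
    nabla G dilatation J K z =
      (1 : Matrix (Idx d) (Idx d) ℝ) J K + raiseSnd G (dilatationCurl G) J K z := by
  have hΓ : z.1 * christoffel G K (idxZero d) J z = ∑ M, ginv G K M z * (z.1 * ((1 / 2) *
      (pd (idxZero d) (G J M) z + pd J (G (idxZero d) M) z - pd M (G (idxZero d) J) z))) := by
    rw [christoffel, Finset.mul_sum, Finset.mul_sum]
    refine Finset.sum_congr rfl fun M _ => ?_
    simp only [ginv]
    ring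
  have hwt : ∑ M, ginv G K M z * (wt J * G M (idxZero d) z) = wt J * wt K := by
    rw [← one_apply_idxZero K, ← h.sum_ginv_mul hz, Finset.mul_sum]
    exact Finset.sum_congr rfl fun _ _ => by ring
  have hone : (1 : Matrix (Idx d) (Idx d) ℝ) J K = (1 : Matrix (Idx d) (Idx d) ℝ) K J := by
    simp only [Matrix.one_apply, eq_comm]
  simp only [raiseSnd, h.dilatationCurl_eq_add_sub hz, mul_sub, mul_add, Finset.sum_sub_distrib,
    Finset.sum_add_distrib] at hΓ ⊢
  rw [h.sum_ginv_mul hz, hwt, ← hΓ, nabla, pd_dilatation, sum_mul_dilatation,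
    h.christoffel_symm hz K J, hone]
  ring

theorem fst_mul_christoffel_trace (h : IsHomogeneousMetricOn Ω G) (hz : z ∈ Ω) :
    z.1 * ∑ K, christoffel G K K (idxZero d) z = d + 1 := by
  have htrace : ∑ K, nabla G dilatation K K z = d + 2 := by
    simp only [h.nabla_dilatation hz, Finset.sum_add_distrib,
      h.raiseSnd_trace (fun J M => dilatationCurl_antisymm G J M z) hz, Matrix.one_apply_eq]
    simp
    ring
  simp only [nabla, pd_dilatation, sum_mul_dilatation, Finset.sum_add_distrib,
    ← Finset.mul_sum] at htrace
  rw [sum_idx (fun K : Idx d => wt K * wt K)] at htrace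
  simp only [wt_inl, wt_inr, mul_one, mul_zero, Finset.sum_const_zero, add_zero] at htrace
  linear_combination htrace

theorem sum_ginv_mul_fst_mul_ricci (h : IsHomogeneousMetricOn Ω G) (hz : z ∈ Ω) (I : Idx d) :
    ∑ J, ginv G I J z * (z.1 * ricci G (idxZero d) J z) =
      ∑ K, pd K (raiseBoth G (dilatationCurl G) I K) z +
        ∑ K, (∑ L, christoffel G L L K z) * raiseBoth G (dilatationCurl G) I K z := by
  rw [← h.sum_ginv_mul_sum_mul_ricci contDiffOn_dilatation h.contDiffOn_dilatationCurl
    (fun J M z _ => dilatationCurl_antisymm G J M z) (fun J K z hz => h.nabla_dilatation hz J K) hz]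
  simp only [mul_comm (dilatation _ _), sum_mul_dilatation (fun L => ricci G L _ z)]

end IsHomogeneousMetricOn

end Homogeneous

/-! ### The lapse and the shift to higher order -/

section NormalMetric

variable {d : ℕ}

/-- A homogeneous metric with `G_{0∞} = t`. -/
structure IsNormalMetricOn (Ω : Opens (Coord d)) (G : Idx d → Idx d → Coord d → ℝ) : Prop
    extends IsHomogeneousMetricOn Ω G where
  pos : ∀ z ∈ Ω, 0 < z.1
  zero_inf : Set.EqOn (G (idxZero d) (idxInf d)) (fun z => z.1) Ω

/-- The deviation of `G_{00}` from `2ρ`. -/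
def lapse (G : Idx d → Idx d → Coord d → ℝ) (z : Coord d) : ℝ :=
  G (idxZero d) (idxZero d) z - 2 * z.2.2

/-- The equations `G_{00} = 2ρ` and `G_{0i} = 0` hold up to terms of order `O(ρ^{n+1})`. -/
structure AgreesToOrder (Ω : Opens (Coord d)) (G : Idx d → Idx d → Coord d → ℝ) (n : ℕ) :
    Prop where
  lapse : IsORho Ω (n + 1) (lapse G)
  shift : ∀ i, IsORho Ω (n + 1) (G (idxZero d) (idxMid i))

/-- The vector field `u^I = g^{IJ} ω_{J∞}` dual to the contraction of `ω = dilatationCurl G` with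
`∂_ρ`. It carries the whole of `ω` up to terms of higher order in `ρ`. -/
def rhoCurl (G : Idx d → Idx d → Coord d → ℝ) (I : Idx d) (z : Coord d) : ℝ :=
  ∑ J, ginv G I J z * dilatationCurl G J (idxInf d) z

/-- The `x`-components of `∂_ρ G_{0j}`, with the index raised. -/
def shiftDeriv (G : Idx d → Idx d → Coord d → ℝ) (i : Fin d) (z : Coord d) : ℝ :=
  ∑ j, ginv G (idxMid i) (idxMid j) z * pd (idxInf d) (G (idxZero d) (idxMid j)) z

theorem dilatationCurl_self (G : Idx d → Idx d → Coord d → ℝ) (J : Idx d) (z : Coord d) :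
    dilatationCurl G J J z = 0 := by
  simp [dilatationCurl]

namespace IsNormalMetricOn

variable {Ω : Opens (Coord d)} {G : Idx d → Idx d → Coord d → ℝ} {z : Coord d} {n : ℕ}

section Components

theorem contDiffOn_inv_fst (h : IsNormalMetricOn Ω G) :
    ContDiffOn ℝ ∞ (fun z : Coord d => z.1⁻¹) Ω :=
  contDiffOn_fst.inv fun z hz => (h.pos z hz).ne'

theorem pd_lapse (h : IsNormalMetricOn Ω G) (hz : z ∈ Ω) (I : Idx d) :
    pd I (lapse G) z = pd I (G (idxZero d) (idxZero d)) z - 2 * (stdVec I).2.2 := by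
  have hrho := differentiableAt_of_contDiffOn (contDiffOn_rho (Ω := Ω)) hz
  change pd I (fun z => G (idxZero d) (idxZero d) z - 2 * z.2.2) z = _
  rw [pd_sub (differentiableAt_of_contDiffOn (h.contDiffOn _ _) hz) (hrho.const_mul 2),
    pd_const_mul hrho, pd_rho]

theorem dilatationCurl_zero_inf (h : IsNormalMetricOn Ω G) (hz : z ∈ Ω) :
    dilatationCurl G (idxZero d) (idxInf d) z = -(1 / 2) * (z.1 * pd (idxInf d) (lapse G) z) := by
  rw [h.dilatationCurl_eq hz, pd_congr h.zero_inf _ hz, h.pd_lapse hz, h.zero_inf hz, pd_fst]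
  simp only [wt_inl, wt_inr, stdVec]
  ring

theorem dilatationCurl_mid_inf (h : IsNormalMetricOn Ω G) (hz : z ∈ Ω) (i : Fin d) :
    dilatationCurl G (idxMid i) (idxInf d) z =
      -(1 / 2) * (z.1 * pd (idxInf d) (G (idxZero d) (idxMid i)) z) := by
  rw [h.dilatationCurl_eq hz, pd_congr h.zero_inf _ hz, pd_fst]
  simp only [wt_inr, stdVec]
  ring

theorem dilatationCurl_mid_zero (h : IsNormalMetricOn Ω G) (hz : z ∈ Ω) (i : Fin d) :
    dilatationCurl G (idxMid i) (idxZero d) z =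
      (1 / 2) * (z.1 * pd (idxMid i) (lapse G) z) - G (idxZero d) (idxMid i) z := by
  rw [h.dilatationCurl_eq hz, h.homogeneous (idxZero d) (idxMid i) z hz, h.pd_lapse hz]
  simp only [wt_inl, wt_inr, stdVec]
  ring

theorem dilatationCurl_mid_mid (h : IsNormalMetricOn Ω G) (hz : z ∈ Ω) (i j : Fin d) :
    dilatationCurl G (idxMid i) (idxMid j) z = (1 / 2) * (z.1 *
      (pd (idxMid i) (G (idxZero d) (idxMid j)) z
        - pd (idxMid j) (G (idxZero d) (idxMid i)) z)) := by
  rw [h.dilatationCurl_eq hz]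
  simp only [wt_inr]
  ring

theorem ginv_inf_eq (h : IsNormalMetricOn Ω G) (hz : z ∈ Ω) (K : Idx d) :
    ginv G K (idxInf d) z = z.1⁻¹ * (wt K - ginv G K (idxZero d) z * (2 * z.2.2 + lapse G z)
      - ∑ i, ginv G K (idxMid i) z * G (idxZero d) (idxMid i) z) := by
  have hinv := h.sum_ginv_mul hz K (idxZero d)
  simp only [sum_idx, one_apply_idxZero, h.symm _ (idxZero d) hz, h.zero_inf hz] at hinv
  have ht := (h.pos z hz).ne'
  rw [lapse]
  field_simp
  linear_combination hinv

end Components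

section Orders

theorem isORho_ginv_inf_sub (h : IsNormalMetricOn Ω G) (hn : AgreesToOrder Ω G n) (K : Idx d) :
    IsORho Ω 1 (fun z => ginv G K (idxInf d) z - wt K * z.1⁻¹) := by
  have hlapse : IsORho Ω 1 (fun z => 2 * z.2.2 + lapse G z) :=
    (IsORho.rho.const_mul 2).add (hn.lapse.mono (by omega))
  have hshift : IsORho Ω 1 (fun z => ∑ i, ginv G K (idxMid i) z * G (idxZero d) (idxMid i) z) :=
    IsORho.sum _ fun i _ => ((hn.shift i).smooth_mul (h.contDiffOn_ginv _ _)).mono (by omega)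
  refine (((hlapse.smooth_mul (h.contDiffOn_ginv K (idxZero d))).add hshift).smooth_mul
    h.contDiffOn_inv_fst |>.const_mul (-1)).congr fun z hz => ?_
  simp only [h.ginv_inf_eq hz]
  ring

theorem isORho_ginv_inf_inr (h : IsNormalMetricOn Ω G) (hn : AgreesToOrder Ω G n)
    (κ : Fin d ⊕ Unit) : IsORho Ω 1 (ginv G (idxInf d) (Sum.inr κ)) :=
  (h.isORho_ginv_inf_sub hn (Sum.inr κ)).congr fun z hz => by
    simp only [wt_inr, zero_mul, sub_zero, h.ginv_symm hz (idxInf d)]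

theorem isORho_dilatationCurl_inf (h : IsNormalMetricOn Ω G) (hn : AgreesToOrder Ω G n)
    (J : Idx d) : IsORho Ω n (dilatationCurl G J (idxInf d)) := by
  rcases J with _ | j | _
  · exact ((hn.lapse.2.2.smooth_mul contDiffOn_fst).const_mul _).congr
      fun _ hz => h.dilatationCurl_zero_inf hz
  · exact (((hn.shift j).2.2.smooth_mul contDiffOn_fst).const_mul _).congr
      fun _ hz => h.dilatationCurl_mid_inf hz j
  · exact IsORho.zero.congr fun z _ => dilatationCurl_self G _ z

theorem isORho_dilatationCurl_mid_zero (h : IsNormalMetricOn Ω G) (hn : AgreesToOrder Ω G n)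
    (i : Fin d) : IsORho Ω (n + 1) (dilatationCurl G (idxMid i) (idxZero d)) :=
  ((((hn.lapse.pd_tangential rfl).smooth_mul contDiffOn_fst).const_mul _).sub
    (hn.shift i)).congr fun _ hz => h.dilatationCurl_mid_zero hz i

theorem isORho_dilatationCurl_zero_mid (h : IsNormalMetricOn Ω G) (hn : AgreesToOrder Ω G n)
    (i : Fin d) : IsORho Ω (n + 1) (dilatationCurl G (idxZero d) (idxMid i)) :=
  ((h.isORho_dilatationCurl_mid_zero hn i).const_mul (-1)).congr fun z _ => by
    simp only [dilatationCurl_antisymm G (idxZero d), neg_one_mul]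

theorem isORho_dilatationCurl_mid_mid (h : IsNormalMetricOn Ω G) (hn : AgreesToOrder Ω G n)
    (i j : Fin d) : IsORho Ω (n + 1) (dilatationCurl G (idxMid i) (idxMid j)) :=
  (((((hn.shift j).pd_tangential rfl).sub ((hn.shift i).pd_tangential rfl)).smooth_mul
    contDiffOn_fst).const_mul _).congr fun _ hz => h.dilatationCurl_mid_mid hz i j

theorem isORho_dilatationCurl_sub (h : IsNormalMetricOn Ω G) (hn : AgreesToOrder Ω G n)
    (J M : Idx d) : IsORho Ω (n + 1) (fun z => dilatationCurl G J M z -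
      (rhoField M z * dilatationCurl G J (idxInf d) z
        - rhoField J z * dilatationCurl G M (idxInf d) z)) := by
  rcases J with _ | j | _ <;> rcases M with _ | m | _
  · exact IsORho.zero.congr fun z _ => by simp [rhoField, dilatationCurl_self]
  · simpa [rhoField] using h.isORho_dilatationCurl_zero_mid hn m
  · exact IsORho.zero.congr fun z _ => by simp [rhoField]
  · simpa [rhoField] using h.isORho_dilatationCurl_mid_zero hn j
  · simpa [rhoField] using h.isORho_dilatationCurl_mid_mid hn j m
  · exact IsORho.zero.congr fun z _ => by simp [rhoField]
  · exact IsORho.zero.congr fun z _ => by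
      simp [rhoField, dilatationCurl_antisymm G (Sum.inl _) (idxInf d)]
  · exact IsORho.zero.congr fun z _ => by
      simp [rhoField, dilatationCurl_antisymm G (idxMid m) (idxInf d)]
  · exact IsORho.zero.congr fun z _ => by simp [rhoField, dilatationCurl_self]

theorem isORho_rhoCurl (h : IsNormalMetricOn Ω G) (hn : AgreesToOrder Ω G n) (I : Idx d) :
    IsORho Ω n (rhoCurl G I) :=
  IsORho.sum _ fun J _ => (h.isORho_dilatationCurl_inf hn J).smooth_mul (h.contDiffOn_ginv I J)

theorem raiseBoth_dilatationCurl_eq (I K : Idx d) :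
    raiseBoth G (dilatationCurl G) I K z =
      (∑ J, ginv G I J z * ∑ M, ginv G K M z * (dilatationCurl G J M z -
        (rhoField M z * dilatationCurl G J (idxInf d) z
          - rhoField J z * dilatationCurl G M (idxInf d) z))) +
      (ginv G K (idxInf d) z * rhoCurl G I z - ginv G I (idxInf d) z * rhoCurl G K z) := by
  have hrho (f : Idx d → ℝ) : ∑ M, rhoField M z * f M = f (idxInf d) := by simp [rhoField]
  have hsnd : ∑ J, ginv G I J z * ∑ M, ginv G K M z * (rhoField M z *
      dilatationCurl G J (idxInf d) z) = ginv G K (idxInf d) z * rhoCurl G I z := by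
    rw [rhoCurl, Finset.mul_sum]
    refine Finset.sum_congr rfl fun J _ => ?_
    rw [← hrho fun M => ginv G K M z, Finset.sum_mul, Finset.mul_sum]
    exact Finset.sum_congr rfl fun M _ => by ring
  have hfst : ∑ J, ginv G I J z * ∑ M, ginv G K M z * (rhoField J z *
      dilatationCurl G M (idxInf d) z) = ginv G I (idxInf d) z * rhoCurl G K z := by
    rw [← hrho fun J => ginv G I J z, Finset.sum_mul]
    refine Finset.sum_congr rfl fun J _ => ?_
    rw [rhoCurl, Finset.mul_sum, Finset.mul_sum]
    exact Finset.sum_congr rfl fun M _ => by ring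
  rw [← hsnd, ← hfst]
  simp only [raiseBoth, raiseSnd, mul_sub, Finset.sum_sub_distrib]
  ring

theorem isORho_raiseBoth_sub (h : IsNormalMetricOn Ω G) (hn : AgreesToOrder Ω G n) (I K : Idx d) :
    IsORho Ω (n + 1) (fun z => raiseBoth G (dilatationCurl G) I K z -
      z.1⁻¹ * (wt K * rhoCurl G I z - wt I * rhoCurl G K z)) := by
  have hcurl := IsORho.sum Finset.univ fun J _ => (IsORho.sum Finset.univ fun M _ =>
    (h.isORho_dilatationCurl_sub hn J M).smooth_mul (h.contDiffOn_ginv K M)).smooth_mul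
      (h.contDiffOn_ginv I J)
  have hmul (I K : Idx d) : IsORho Ω (n + 1)
      (fun z => (ginv G K (idxInf d) z - wt K * z.1⁻¹) * rhoCurl G I z) :=
    ((h.isORho_ginv_inf_sub hn K).mul (h.isORho_rhoCurl hn I)).mono (by omega)
  refine (hcurl.add ((hmul I K).sub (hmul K I))).congr fun z _ => ?_
  simp only [raiseBoth_dilatationCurl_eq]
  ring

theorem isORho_raiseBoth_inr_inr (h : IsNormalMetricOn Ω G) (hn : AgreesToOrder Ω G n)
    (κ μ : Fin d ⊕ Unit) :
    IsORho Ω (n + 1) (raiseBoth G (dilatationCurl G) (Sum.inr κ) (Sum.inr μ)) := by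
  simpa using h.isORho_raiseBoth_sub hn (Sum.inr κ) (Sum.inr μ)

theorem isORho_raiseBoth_inr_zero_sub (h : IsNormalMetricOn Ω G) (hn : AgreesToOrder Ω G n)
    (κ : Fin d ⊕ Unit) : IsORho Ω (n + 1) (fun z =>
      raiseBoth G (dilatationCurl G) (Sum.inr κ) (idxZero d) z
        - z.1⁻¹ * rhoCurl G (Sum.inr κ) z) := by
  simpa using h.isORho_raiseBoth_sub hn (Sum.inr κ) (idxZero d)

theorem isORho_maxwell (h : IsNormalMetricOn Ω G) (hn : AgreesToOrder Ω G n)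
    (hric : ∀ J, IsORho Ω (n + 1) (ricci G (idxZero d) J)) (κ : Fin d ⊕ Unit) :
    IsORho Ω (n + 1) (fun z =>
      z.1 * pd (idxInf d) (raiseBoth G (dilatationCurl G) (Sum.inr κ) (idxInf d)) z
        + d * raiseBoth G (dilatationCurl G) (Sum.inr κ) (idxZero d) z) := by
  let F := raiseBoth G (dilatationCurl G) (Sum.inr κ)
  let Γ (K : Idx d) (z : Coord d) : ℝ := ∑ L, christoffel G L L K z
  have hΓ (K : Idx d) : ContDiffOn ℝ ∞ (Γ K) Ω :=
    ContDiffOn.sum fun L _ => h.contDiffOn_christoffel L L K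
  have hdiv := (IsORho.sum Finset.univ fun J _ =>
    ((hric J).smooth_mul contDiffOn_fst).smooth_mul (h.contDiffOn_ginv (Sum.inr κ) J))
  have hF (μ : Fin d ⊕ Unit) := h.isORho_raiseBoth_inr_inr hn κ μ
  have hpd : IsORho Ω (n + 1) (fun z => ∑ i, pd (idxMid i) (F (idxMid i)) z) :=
    IsORho.sum _ fun i _ => (hF (Sum.inl i)).pd_tangential rfl
  have hΓF : IsORho Ω (n + 1) (fun z => ∑ i, Γ (idxMid i) z * F (idxMid i) z) :=
    IsORho.sum _ fun i _ => (hF (Sum.inl i)).smooth_mul (hΓ _)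
  refine (((hdiv.sub hpd).sub (hΓF.add ((hF (Sum.inr ())).smooth_mul (hΓ (idxInf d))))).smooth_mul
    contDiffOn_fst).congr fun z hz => ?_
  have hmaxwell : ∑ J, ginv G (Sum.inr κ) J z * (z.1 * ricci G (idxZero d) J z) =
      ∑ K, pd K (F K) z + ∑ K, Γ K z * F K z := h.sum_ginv_mul_fst_mul_ricci hz _
  rw [sum_idx fun K => pd K (F K) z, sum_idx fun K => Γ K z * F K z] at hmaxwell
  have hhom : z.1 * pd (idxZero d) (F (idxZero d)) z = -F (idxZero d) z := by
    rw [h.homogeneous_raiseBoth h.contDiffOn_dilatationCurl h.homogeneous_dilatationCurl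
      (Sum.inr κ) (idxZero d) z hz, wt_inl, wt_inr]
    ring
  have htrace : z.1 * Γ (idxZero d) z = d + 1 := h.fst_mul_christoffel_trace hz
  linear_combination -F (idxZero d) z * htrace - hhom - z.1 * hmaxwell

theorem isORho_rhoCurl_inf_sub (h : IsNormalMetricOn Ω G) (hn : AgreesToOrder Ω G n) :
    IsORho Ω (n + 1) (fun z =>
      rhoCurl G (idxInf d) z - z.1⁻¹ * dilatationCurl G (idxZero d) (idxInf d) z) := by
  refine (IsORho.sum Finset.univ fun J _ => ((h.isORho_ginv_inf_sub hn J).mul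
    (h.isORho_dilatationCurl_inf hn J)).mono (n := n + 1) (by omega)).congr fun z hz => ?_
  simp only [rhoCurl, h.ginv_symm hz (idxInf d), sub_mul, Finset.sum_sub_distrib, mul_assoc]
  congr 1
  simp

theorem isORho_pd_lapse (h : IsNormalMetricOn Ω G) (hn : AgreesToOrder Ω G n)
    (hric : ∀ J, IsORho Ω (n + 1) (ricci G (idxZero d) J)) (hd : d ≠ 0) :
    IsORho Ω (n + 1) (pd (idxInf d) (lapse G)) := by
  have hself : Set.EqOn (raiseBoth G (dilatationCurl G) (idxInf d) (idxInf d)) (fun _ => 0) Ω :=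
    fun z _ => by
      linarith [raiseBoth_antisymm G (fun J M => dilatationCurl_antisymm G J M z)
        (idxInf d) (idxInf d)]
  have hF : IsORho Ω (n + 1) (raiseBoth G (dilatationCurl G) (idxInf d) (idxZero d)) := by
    refine IsORho.of_const_mul (Nat.cast_ne_zero.2 hd : (d : ℝ) ≠ 0)
      ((h.isORho_maxwell hn hric (Sum.inr ())).congr fun z hz => ?_)
    simp only [pd_congr hself _ hz, pd_const]
    ring
  refine (((hF.sub (h.isORho_raiseBoth_inr_zero_sub hn (Sum.inr ()))).smooth_mul contDiffOn_fst
    |>.sub (h.isORho_rhoCurl_inf_sub hn)).const_mul (-2)).congr fun z hz => ?_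
  simp only [h.dilatationCurl_zero_inf hz]
  have ht := (h.pos z hz).ne'
  field_simp
  ring

theorem isORho_lapse_succ (h : IsNormalMetricOn Ω G) (hn : AgreesToOrder Ω G n)
    (hric : ∀ J, IsORho Ω (n + 1) (ricci G (idxZero d) J)) (hd : d ≠ 0) :
    IsORho Ω (n + 2) (lapse G) :=
  ⟨hn.lapse.1, hn.lapse.2.1, h.isORho_pd_lapse hn hric hd⟩

theorem isORho_dilatationCurl_zero_inf (h : IsNormalMetricOn Ω G)
    (hlapse : IsORho Ω (n + 2) (lapse G)) :
    IsORho Ω (n + 1) (dilatationCurl G (idxZero d) (idxInf d)) :=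
  ((hlapse.2.2.smooth_mul contDiffOn_fst).const_mul _).congr fun _ hz =>
    h.dilatationCurl_zero_inf hz

theorem isORho_raiseBoth_mid_zero_add (h : IsNormalMetricOn Ω G) (hn : AgreesToOrder Ω G n)
    (hlapse : IsORho Ω (n + 2) (lapse G)) (i : Fin d) :
    IsORho Ω (n + 1) (fun z => raiseBoth G (dilatationCurl G) (idxMid i) (idxZero d) z
      + (1 / 2) * shiftDeriv G i z) := by
  have hzero := ((h.isORho_dilatationCurl_zero_inf hlapse).smooth_mul
    (h.contDiffOn_ginv (idxMid i) (idxZero d))).smooth_mul h.contDiffOn_inv_fst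
  refine ((h.isORho_raiseBoth_inr_zero_sub hn (Sum.inl i)).add hzero).congr fun z hz => ?_
  have hmid : ∑ j, ginv G (idxMid i) (idxMid j) z * dilatationCurl G (idxMid j) (idxInf d) z =
      -(1 / 2) * (z.1 * shiftDeriv G i z) := by
    simp only [shiftDeriv, Finset.mul_sum, h.dilatationCurl_mid_inf hz]
    exact Finset.sum_congr rfl fun _ _ => by ring
  have ht := (h.pos z hz).ne'
  simp only [rhoCurl, sum_idx, hmid, dilatationCurl_self]
  field_simp
  ring

theorem isORho_raiseSnd_inf_inf (h : IsNormalMetricOn Ω G) (hn : AgreesToOrder Ω G n)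
    (hlapse : IsORho Ω (n + 2) (lapse G)) :
    IsORho Ω (n + 1) (raiseSnd G (dilatationCurl G) (idxInf d) (idxInf d)) := by
  refine (((h.isORho_rhoCurl_inf_sub hn).add ((h.isORho_dilatationCurl_zero_inf hlapse).smooth_mul
    h.contDiffOn_inv_fst)).const_mul (-1)).congr fun z _ => ?_
  simp only [raiseSnd, rhoCurl, dilatationCurl_antisymm G (idxInf d), mul_neg,
    Finset.sum_neg_distrib]
  ring

theorem isORho_raiseSnd_zero_inf (h : IsNormalMetricOn Ω G) (hn : AgreesToOrder Ω G n)
    (hlapse : IsORho Ω (n + 2) (lapse G)) :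
    IsORho Ω (n + 2) (raiseSnd G (dilatationCurl G) (idxZero d) (idxInf d)) := by
  have hmid := IsORho.sum Finset.univ fun i _ => (h.isORho_ginv_inf_inr hn (Sum.inl i)).mul
    (h.isORho_dilatationCurl_zero_mid hn i)
  have hinf := (h.isORho_ginv_inf_inr hn (Sum.inr ())).mul (h.isORho_dilatationCurl_zero_inf hlapse)
  refine ((hmid.add hinf).mono (by omega)).congr fun z _ => ?_
  simp only [raiseSnd, sum_idx, dilatationCurl_self]
  ring

theorem isORho_ginv_inf_inf_add (h : IsNormalMetricOn Ω G) (hn : AgreesToOrder Ω G n)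
    (hlapse : IsORho Ω (n + 2) (lapse G)) :
    IsORho Ω 2 (fun z => ginv G (idxInf d) (idxInf d) z + 2 * (z.1⁻¹ * (z.1⁻¹ * z.2.2))) := by
  have hzero := ((h.isORho_ginv_inf_sub hn (idxZero d)).mul IsORho.rho).const_mul 2
  have hlapse' := (hlapse.mono (n := 2) (by omega)).smooth_mul
    (h.contDiffOn_ginv (idxInf d) (idxZero d))
  have hshift := IsORho.sum Finset.univ fun i _ => (((h.isORho_ginv_inf_inr hn (Sum.inl i)).mul
    (hn.shift i)).mono (n := 2) (by omega))
  refine ((((hzero.add hlapse').add hshift).smooth_mul h.contDiffOn_inv_fst).const_mul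
    (-1)).congr fun z hz => ?_
  simp only [h.ginv_inf_eq hz (idxInf d), h.ginv_symm hz (idxZero d) (idxInf d), wt_inl, wt_inr]
  ring

theorem isORho_raiseSnd_mid_inf_sub (h : IsNormalMetricOn Ω G) (hn : AgreesToOrder Ω G n)
    (hlapse : IsORho Ω (n + 2) (lapse G)) (j : Fin d) :
    IsORho Ω (n + 2) (fun z => raiseSnd G (dilatationCurl G) (idxMid j) (idxInf d) z
      - n * (z.1⁻¹ * G (idxZero d) (idxMid j) z)) := by
  have hzero := ((h.isORho_ginv_inf_sub hn (idxZero d)).mul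
    (h.isORho_dilatationCurl_mid_zero hn j)).mono (n := n + 2) (by omega)
  have hlapse' := (hlapse.pd_tangential (I := idxMid j) rfl).const_mul (1 / 2)
  have hmid := (IsORho.sum Finset.univ fun k _ => (h.isORho_ginv_inf_inr hn (Sum.inl k)).mul
    (h.isORho_dilatationCurl_mid_mid hn j k)).mono (n := n + 2) (by omega)
  have hinf := ((h.isORho_ginv_inf_inf_add hn hlapse).mul
    (h.isORho_dilatationCurl_inf hn (idxMid j))).mono (n := n + 2) (by omega)
  have heuler := (hn.shift j).euler.smooth_mul h.contDiffOn_inv_fst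
  refine ((((hzero.add hlapse').add hmid).add hinf).add heuler).congr fun z hz => ?_
  have ht := (h.pos z hz).ne'
  simp only [raiseSnd, sum_idx, h.ginv_symm hz (idxZero d) (idxInf d), wt_inl,
    h.dilatationCurl_mid_zero hz, h.dilatationCurl_mid_inf hz]
  push_cast
  field_simp
  ring

theorem isORho_raiseBoth_mid_inf_sub (h : IsNormalMetricOn Ω G) (hn : AgreesToOrder Ω G n)
    (hlapse : IsORho Ω (n + 2) (lapse G)) (i : Fin d) :
    IsORho Ω (n + 2) (fun z => raiseBoth G (dilatationCurl G) (idxMid i) (idxInf d) z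
      - ∑ j, n * z.1⁻¹ * ginv G (idxMid i) (idxMid j) z * G (idxZero d) (idxMid j) z) := by
  have hzero := (h.isORho_raiseSnd_zero_inf hn hlapse).smooth_mul
    (h.contDiffOn_ginv (idxMid i) (idxZero d))
  have hmid := IsORho.sum Finset.univ fun j _ =>
    (h.isORho_raiseSnd_mid_inf_sub hn hlapse j).smooth_mul
      (h.contDiffOn_ginv (idxMid i) (idxMid j))
  have hinf := ((h.isORho_ginv_inf_inr hn (Sum.inl i)).mul
    (h.isORho_raiseSnd_inf_inf hn hlapse)).mono (n := n + 2) (by omega)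
  refine ((hzero.add hmid).add hinf).congr fun z hz => ?_
  have hsum : ∑ j, ginv G (idxMid i) (idxMid j) z * (n * (z.1⁻¹ * G (idxZero d) (idxMid j) z)) =
      ∑ j, n * z.1⁻¹ * ginv G (idxMid i) (idxMid j) z * G (idxZero d) (idxMid j) z :=
    Finset.sum_congr rfl fun _ _ => by ring
  simp only [raiseBoth, sum_idx, h.ginv_symm hz (idxInf d) (idxMid i), mul_sub,
    Finset.sum_sub_distrib, hsum]
  ring

theorem isORho_pd_raiseBoth_mid_inf_sub (h : IsNormalMetricOn Ω G) (hn : AgreesToOrder Ω G n)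
    (hlapse : IsORho Ω (n + 2) (lapse G)) (i : Fin d) :
    IsORho Ω (n + 1) (fun z =>
      z.1 * pd (idxInf d) (raiseBoth G (dilatationCurl G) (idxMid i) (idxInf d)) z
        - n * shiftDeriv G i z) := by
  let c (j : Fin d) (z : Coord d) : ℝ := n * z.1⁻¹ * ginv G (idxMid i) (idxMid j) z
  have hc (j : Fin d) : ContDiffOn ℝ ∞ (c j) Ω :=
    (contDiffOn_const.mul h.contDiffOn_inv_fst).mul (h.contDiffOn_ginv _ _)
  have hS (j : Fin d) : ContDiffOn ℝ ∞ (G (idxZero d) (idxMid j)) Ω := h.contDiffOn _ _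
  have hcS : ContDiffOn ℝ ∞ (fun z => ∑ j, c j z * G (idxZero d) (idxMid j) z) Ω :=
    ContDiffOn.sum fun j _ => (hc j).mul (hS j)
  have hF := h.contDiffOn_raiseBoth h.contDiffOn_dilatationCurl (idxMid i) (idxInf d)
  have hpd : IsORho Ω (n + 1) (pd (idxInf d) fun z =>
      raiseBoth G (dilatationCurl G) (idxMid i) (idxInf d) z
        - ∑ j, c j z * G (idxZero d) (idxMid j) z) :=
    (h.isORho_raiseBoth_mid_inf_sub hn hlapse i).2.2
  have hpdc := IsORho.sum Finset.univ fun j _ =>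
    (hn.shift j).smooth_mul (contDiffOn_pd (hc j) (idxInf d))
  refine ((hpd.add hpdc).smooth_mul contDiffOn_fst).congr fun z hz => ?_
  have hsum : ∑ j, c j z * pd (idxInf d) (G (idxZero d) (idxMid j)) z =
      n * z.1⁻¹ * shiftDeriv G i z := by
    rw [shiftDeriv, Finset.mul_sum]
    exact Finset.sum_congr rfl fun j _ => by simp only [c]; ring
  simp only [pd_sub (differentiableAt_of_contDiffOn hF hz) (differentiableAt_of_contDiffOn hcS hz),
    pd_sum_mul _ (fun j _ => differentiableAt_of_contDiffOn (hc j) hz)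
      fun j _ => differentiableAt_of_contDiffOn (hS j) hz, Finset.sum_add_distrib, hsum]
  have ht := (h.pos z hz).ne'
  field_simp
  ring

theorem isORho_shiftDeriv (h : IsNormalMetricOn Ω G) (hn : AgreesToOrder Ω G n)
    (hric : ∀ J, IsORho Ω (n + 1) (ricci G (idxZero d) J))
    (hlapse : IsORho Ω (n + 2) (lapse G)) (hnd : 2 * n ≠ d) (i : Fin d) :
    IsORho Ω (n + 1) (shiftDeriv G i) := by
  have hcoeff : (n : ℝ) - d / 2 ≠ 0 := fun h0 => hnd (by
    exact_mod_cast (by linarith : (2 * n : ℝ) = d))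
  refine IsORho.of_const_mul hcoeff ((((h.isORho_maxwell hn hric (Sum.inl i)).sub
    ((h.isORho_raiseBoth_mid_zero_add hn hlapse i).const_mul d)).sub
    (h.isORho_pd_raiseBoth_mid_inf_sub hn hlapse i)).congr fun z _ => ?_)
  ring

theorem pd_shift_eq (h : IsNormalMetricOn Ω G) (hz : z ∈ Ω) (k : Fin d) :
    pd (idxInf d) (G (idxZero d) (idxMid k)) z =
      ∑ i, G (idxMid k) (idxMid i) z * shiftDeriv G i z
        + G (idxZero d) (idxMid k) z *
          ∑ j, ginv G (idxZero d) (idxMid j) z * pd (idxInf d) (G (idxZero d) (idxMid j)) z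
        + G (idxMid k) (idxInf d) z *
          ∑ j, ginv G (idxInf d) (idxMid j) z * pd (idxInf d) (G (idxZero d) (idxMid j)) z := by
  let q (j : Fin d) : ℝ := pd (idxInf d) (G (idxZero d) (idxMid j)) z
  calc q k = ∑ j, (∑ K, G (idxMid k) K z * ginv G K (idxMid j) z) * q j := by
        simp [h.sum_mul_ginv hz, Matrix.one_apply]
    _ = ∑ K, G (idxMid k) K z * ∑ j, ginv G K (idxMid j) z * q j := by
        simp only [Finset.sum_mul, Finset.mul_sum, mul_assoc]
        exact Finset.sum_comm
    _ = _ := by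
        rw [sum_idx, h.symm _ (idxZero d) hz]
        simp only [q, shiftDeriv]
        ring

theorem isORho_pd_shift (h : IsNormalMetricOn Ω G) (hn : AgreesToOrder Ω G n)
    (hP : ∀ i, IsORho Ω (n + 1) (shiftDeriv G i)) (k : Fin d) :
    IsORho Ω (n + 1) (pd (idxInf d) (G (idxZero d) (idxMid k))) := by
  have hmid := IsORho.sum Finset.univ fun i _ =>
    (hP i).smooth_mul (h.contDiffOn (idxMid k) (idxMid i))
  have hzero := (hn.shift k).mul (n := 0) (ContDiffOn.sum fun j (_ : j ∈ Finset.univ) =>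
    (h.contDiffOn_ginv (idxZero d) (idxMid j)).mul (hn.shift j).2.2.contDiffOn)
  have hinf := (IsORho.sum Finset.univ fun j _ => (h.isORho_ginv_inf_inr hn (Sum.inl j)).mul
    (hn.shift j).2.2).smooth_mul (h.contDiffOn (idxMid k) (idxInf d))
  exact ((hmid.add hzero).add (hinf.mono (by omega))).congr fun _ hz => h.pd_shift_eq hz k

theorem isORho_shift_succ (h : IsNormalMetricOn Ω G) (hn : AgreesToOrder Ω G n)
    (hric : ∀ J, IsORho Ω (n + 1) (ricci G (idxZero d) J))
    (hlapse : IsORho Ω (n + 2) (lapse G)) (hnd : 2 * n ≠ d) (k : Fin d) :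
    IsORho Ω (n + 2) (G (idxZero d) (idxMid k)) :=
  ⟨(hn.shift k).1, (hn.shift k).2.1,
    h.isORho_pd_shift hn (h.isORho_shiftDeriv hn hric hlapse hnd) k⟩

theorem agreesToOrder (h : IsNormalMetricOn Ω G) (hzero : AgreesToOrder Ω G 0)
    (hric : ∀ m J, IsORho Ω m (ricci G (idxZero d) J)) {m : ℕ} (hm : Odd d ∨ 2 * m ≤ d) :
    AgreesToOrder Ω G m := by
  induction m with
  | zero => exact hzero
  | succ n ih =>
    have hn := ih (hm.imp_right fun hm => by omega)
    have hnd : 2 * n ≠ d := by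
      rintro rfl
      rcases hm with hodd | hle
      · exact Nat.not_odd_iff_even.2 (even_two_mul n) hodd
      · omega
    have hd : d ≠ 0 := by
      rintro rfl
      simp at hm
    have hlapse := h.isORho_lapse_succ hn (hric _) hd
    exact ⟨hlapse, h.isORho_shift_succ hn (hric _) hlapse hnd⟩

end Orders

end IsNormalMetricOn

end NormalMetric

/-! ### Ambient coordinates on an ambient space -/

theorem integral_pd_rho {d : ℕ} {Ω : Opens (Coord d)} {f : Coord d → ℝ}
    (hf : ContDiffOn ℝ ∞ f Ω) {t ρ : ℝ} {y : Eucl d}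
    (hline : ∀ s ∈ Set.uIcc 0 ρ, ((t, y, s) : Coord d) ∈ Ω) :
    ∫ s in (0 : ℝ)..ρ, pd (idxInf d) f (t, y, s) = f (t, y, ρ) - f (t, y, 0) := by
  have hcont : Continuous fun s : ℝ => ((t, y, s) : Coord d) := by fun_prop
  refine intervalIntegral.integral_eq_sub_of_hasDerivAt (f := fun s => f (t, y, s))
    (fun s hs => ?_) ?_
  · have hderiv : HasDerivAt (fun s : ℝ => ((t, y, s) : Coord d)) (stdVec (idxInf d)) s :=
      (hasDerivAt_const s t).prodMk ((hasDerivAt_const s y).prodMk (hasDerivAt_id s))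
    exact (differentiableAt_of_contDiffOn hf (hline s hs)).hasFDerivAt.comp_hasDerivAt s hderiv
  · exact ((contDiffOn_pd hf _).continuousOn.comp hcont.continuousOn hline).intervalIntegrable

theorem eq_of_pd_rho_eq_zero {d : ℕ} {Ω : Opens (Coord d)} {f : Coord d → ℝ}
    (hf : ContDiffOn ℝ ∞ f Ω) {t ρ : ℝ} {y : Eucl d}
    (hline : ∀ s ∈ Set.uIcc 0 ρ, ((t, y, s) : Coord d) ∈ Ω)
    (hpd : ∀ s ∈ Set.uIcc 0 ρ, pd (idxInf d) f (t, y, s) = 0) :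
    f (t, y, ρ) = f (t, y, 0) := by
  rw [← sub_eq_zero, ← integral_pd_rho hf hline, intervalIntegral.integral_congr hpd,
    intervalIntegral.integral_zero]

theorem exists_basis_prod {d : ℕ} {V : Type*} [AddCommGroup V] [Module ℝ V]
    (e : Eucl d ≃ₗ[ℝ] V) : ∃ b : Module.Basis (Idx d) ℝ (ℝ × V × ℝ), b (idxZero d) = (1, 0, 0) ∧
      (∀ i, b (idxMid i) = (0, e (EuclideanSpace.single i 1), 0)) ∧ b (idxInf d) = (0, 0, 1) := by
  let b₀ : Module.Basis (Idx d) ℝ (Coord d) := (Module.Basis.singleton Unit ℝ).prod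
    ((EuclideanSpace.basisFun (Fin d) ℝ).toBasis.prod (Module.Basis.singleton Unit ℝ))
  refine ⟨b₀.map ((LinearEquiv.refl ℝ ℝ).prodCongr (e.prodCongr (LinearEquiv.refl ℝ ℝ))),
    ?_, fun i => ?_, ?_⟩ <;> simp [b₀]

theorem apply_sum_smul_mid {V ι : Type*} [AddCommGroup V] [Module ℝ V] [Fintype ι]
    (B : LinearMap.BilinForm ℝ (ℝ × V × ℝ)) (u : ℝ × V × ℝ) (c : ι → ℝ) (e : ι → V) :
    B u (0, ∑ i, c i • e i, 0) = ∑ i, c i * B u (0, e i, 0) := by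
  let ℓ : V →ₗ[ℝ] ℝ := B u ∘ₗ LinearMap.inr ℝ ℝ (V × ℝ) ∘ₗ LinearMap.inl ℝ V ℝ
  change ℓ (∑ i, c i • e i) = ∑ i, c i • ℓ (e i)
  simp only [map_sum, map_smul]

section Frames

variable {d : ℕ} {M : Type*} [TopologicalSpace M] [ChartedSpace (Eucl d) M]

theorem isOpen_coordDomain (x₀ : M) {N : Set (ℝ × M × ℝ)} (hN : IsOpen N) :
    IsOpen (coordDomain (d := d) x₀ N) := by
  have hcont : ContinuousOn (ambPoint (d := d) x₀)
      {z : Coord d | z.2.1 ∈ (extChartAt (𝓡 d) x₀).target} :=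
    continuousOn_fst.prodMk (((continuousOn_extChartAt_symm x₀).comp
      (continuous_fst.comp continuous_snd).continuousOn fun _ h => h).prodMk
        (continuous_snd.comp continuous_snd).continuousOn)
  exact hcont.isOpen_inter_preimage
    ((isOpen_extChartAt_target x₀).preimage (continuous_fst.comp continuous_snd)) hN

/-- `coordDomain x₀ N` as an open set of the coordinate space. -/
def coordOpens (x₀ : M) {N : Set (ℝ × M × ℝ)} (hN : IsOpen N) : Opens (Coord d) :=
  ⟨coordDomain x₀ N, isOpen_coordDomain x₀ hN⟩

theorem exists_ambPoint_eq {N : Set (ℝ × M × ℝ)} {z : ℝ × M × ℝ} (hz : z ∈ N) :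
    ∃ (x₀ : M) (z' : Coord d), z' ∈ coordDomain x₀ N ∧ ambPoint x₀ z' = z := by
  have hpoint : ambPoint z.2.1 (z.1, extChartAt (𝓡 d) z.2.1 z.2.1, z.2.2) = z := by
    simp [ambPoint]
  exact ⟨z.2.1, _, ⟨mem_extChartAt_target _, hpoint.symm ▸ hz⟩, hpoint⟩

theorem dilate_ambFrame (x₀ : M) (z : Coord d) (s : ℝ) (I : Idx d) :
    ((s * (ambFrame x₀ z I).1, (ambFrame x₀ z I).2) : Tan (d := d) (ambPoint x₀ z)) =
      s ^ wt I • ambFrame x₀ (s * z.1, z.2) I := by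
  rcases I with _ | i | _ <;> simp [ambFrame, Real.rpow_one, Real.rpow_zero] <;> rfl

variable [IsManifold (𝓡 d) ∞ M]

theorem exists_coordEquiv (x₀ : M) {y : Eucl d} (hy : y ∈ (extChartAt (𝓡 d) x₀).target) :
    ∃ e : Eucl d ≃ₗ[ℝ] TangentSpace (𝓡 d) ((extChartAt (𝓡 d) x₀).symm y),
      ∀ i, e (EuclideanSpace.single i 1) = coordVec x₀ y i := by
  have hinv := isInvertible_mfderivWithin_extChartAt_symm (I := 𝓡 d) hy
  rw [ModelWithCorners.range_eq_univ, mfderivWithin_univ] at hinv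
  obtain ⟨e, he⟩ := hinv
  exact ⟨e.toLinearEquiv, fun i => congrArg (fun l => l (EuclideanSpace.single i 1)) he⟩

theorem exists_eq_sum_coordVec (x₀ : M) {y : Eucl d} (hy : y ∈ (extChartAt (𝓡 d) x₀).target)
    (v : TangentSpace (𝓡 d) ((extChartAt (𝓡 d) x₀).symm y)) :
    ∃ c : Fin d → ℝ, v = ∑ i, c i • coordVec x₀ y i := by
  obtain ⟨e, he⟩ := exists_coordEquiv x₀ hy
  refine ⟨fun i => e.symm v i, e.symm.injective ?_⟩
  simp only [← he, map_sum, map_smul, LinearEquiv.symm_apply_apply]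
  ext j
  simp [Pi.single_apply]

theorem exists_basis_ambFrame (x₀ : M) {z : Coord d}
    (hz : z.2.1 ∈ (extChartAt (𝓡 d) x₀).target) :
    ∃ b : Module.Basis (Idx d) ℝ (Tan (d := d) (ambPoint x₀ z)), ∀ I, b I = ambFrame x₀ z I := by
  obtain ⟨e, he⟩ := exists_coordEquiv x₀ hz
  obtain ⟨b, hzero, hmid, hinf⟩ := exists_basis_prod e
  refine ⟨b, ?_⟩
  rintro (_ | i | _)
  · exact hzero
  · exact (hmid i).trans (congrArg (fun v => (0, v, 0)) (he i))
  · exact hinf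

theorem det_compMatrix_comp_ne_zero (x₀ : M) {G : BilinField d M} {z : Coord d}
    (hz : z.2.1 ∈ (extChartAt (𝓡 d) x₀).target) (hG : (G (ambPoint x₀ z)).Nondegenerate) :
    (compMatrix (comp x₀ G) z).det ≠ 0 := by
  obtain ⟨b, hb⟩ := exists_basis_ambFrame x₀ hz
  convert (LinearMap.BilinForm.nondegenerate_iff_det_ne_zero b).1 hG using 2
  ext I J
  simp [LinearMap.BilinForm.toMatrix_apply, hb, comp]

end Frames

theorem IsHomogeneousOn.of_dilatation {d : ℕ} {Ω : Opens (Coord d)} {c : ℝ} {f : Coord d → ℝ}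
    (hf : ContDiffOn ℝ ∞ f Ω)
    (h : ∀ z ∈ Ω, ∀ s : ℝ, 0 < s → f (s * z.1, z.2) = s ^ c * f z) : IsHomogeneousOn Ω c f := by
  intro z hz
  have hone : ((1 * z.1, z.2) : Coord d) = z := by rw [one_mul]
  have hline : HasDerivAt (fun s : ℝ => ((s * z.1, z.2) : Coord d))
      (z.1 • stdVec (idxZero d)) 1 := by
    refine (((hasDerivAt_id (1 : ℝ)).mul_const z.1).prodMk
      (hasDerivAt_const (1 : ℝ) z.2)).congr_deriv ?_
    change _ = z.1 • ((1, 0) : Coord d)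
    simp
  have hcomp : HasDerivAt (fun s : ℝ => f (s * z.1, z.2))
      (z.1 * WeylAmbient.pd (idxZero d) f z) 1 := by
    have hdiff : HasFDerivAt f (fderiv ℝ f z) (1 * z.1, z.2) :=
      hone.symm ▸ (differentiableAt_of_contDiffOn hf hz).hasFDerivAt
    exact (hdiff.comp_hasDerivAt 1 hline).congr_deriv (map_smul _ _ _)
  have hpow : HasDerivAt (fun s : ℝ => s ^ c * f z) (c * f z) 1 := by
    simpa using (Real.hasDerivAt_rpow_const (p := c) (Or.inl one_ne_zero)).mul_const (f z)
  refine hcomp.unique (hpow.congr_of_eventuallyEq ?_)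
  filter_upwards [lt_mem_nhds (zero_lt_one (α := ℝ))] with s hs using h z hz s hs

theorem covDeriv_rhoField {d : ℕ} (G : Idx d → Idx d → Coord d → ℝ) (K : Idx d) (z : Coord d) :
    covDeriv G rhoField rhoField K z = christoffel G K (idxInf d) (idxInf d) z := by
  have hpd (I : Idx d) : pd I (rhoField (d := d) K) z = 0 := pd_const _ I
  simp [covDeriv, hpd, rhoField]

/-! ### Weyl-normal form: the exact components -/

section NormalForm

variable {d p q : ℕ} {M : Type*} [TopologicalSpace M] [ChartedSpace (Eucl d) M]
  {r : WeylPair d M p q} {N : Set (ℝ × M × ℝ)} {G : BilinField d M}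
  {A : ∀ z : ℝ × M × ℝ, Tan (d := d) z}

namespace IsWeylPreAmbient

theorem apply_comm (hG : IsWeylPreAmbient r N G) {z : ℝ × M × ℝ} (hz : z ∈ N)
    (v w : Tan (d := d) z) : G z v w = G z w v :=
  (hG.signature z hz).1.eq v w

theorem one_mem (hG : IsWeylPreAmbient r N G) {t ρ : ℝ} {x : M}
    (hz : (t, x, ρ) ∈ N) : (1, x, ρ) ∈ N := by
  have ht := hG.pos _ hz
  simpa [ht.ne'] using hG.dilatation t⁻¹ t x ρ (inv_pos.2 ht) hz

theorem apply_inr (hG : IsWeylPreAmbient r N G) {t ρ : ℝ} {x : M}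
    (hz : (t, x, ρ) ∈ N) (v w : TangentSpace (𝓡 d) x) (α β : ℝ) :
    G (t, x, ρ) (0, v, α) (0, w, β) = t ^ 2 * G (1, x, ρ) (0, v, α) (0, w, β) := by
  have hhom := hG.homogeneous t 1 x ρ (hG.pos _ hz) (hG.one_mem hz) 0 0 v w α β
  rwa [mul_one, mul_zero] at hhom

theorem apply_zero_of_rho_eq_zero (hG : IsWeylPreAmbient r N G) {t : ℝ} (ht : 0 < t) (x : M)
    (w : ℝ × TangentSpace (𝓡 d) x) : G (t, x, 0) (1, 0, 0) (w.1, w.2, 0) = 0 := by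
  rw [hG.pullback t x ht (1, 0) w]
  simp [tautological]

theorem comp_dilatation (hG : IsWeylPreAmbient r N G) (x₀ : M) (I J : Idx d) {s : ℝ} (hs : 0 < s)
    {z : Coord d} (hz : z ∈ coordDomain x₀ N) :
    comp x₀ G I J (s * z.1, z.2) = s ^ (2 - wt I - wt J) * comp x₀ G I J z := by
  have hhom : G (ambPoint x₀ (s * z.1, z.2)) (s ^ wt I • ambFrame x₀ (s * z.1, z.2) I)
      (s ^ wt J • ambFrame x₀ (s * z.1, z.2) J) = s ^ 2 * comp x₀ G I J z := by
    rw [← dilate_ambFrame, ← dilate_ambFrame]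
    exact hG.homogeneous s z.1 _ z.2.2 hs hz.2 _ _ _ _ _ _
  rw [map_smul, map_smul, LinearMap.smul_apply, smul_eq_mul, smul_eq_mul] at hhom
  change s ^ wt J * (s ^ wt I * comp x₀ G I J (s * z.1, z.2)) = _ at hhom
  have hI := (Real.rpow_pos_of_pos hs (wt I)).ne'
  have hJ := (Real.rpow_pos_of_pos hs (wt J)).ne'
  rw [Real.rpow_sub hs, Real.rpow_sub hs, Real.rpow_two]
  field_simp
  linear_combination hhom

variable [IsManifold (𝓡 d) ∞ M]

theorem isMetricOn (hG : IsWeylPreAmbient r N G) (x₀ : M) :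
    IsMetricOn (coordOpens x₀ hG.isOpen) (comp x₀ G) where
  contDiffOn := hG.smooth x₀
  symm _ _ _ hz := hG.apply_comm hz.2 _ _
  det_ne_zero _ hz := det_compMatrix_comp_ne_zero x₀ hz.1 (hG.signature _ hz.2).2.1

theorem isHomogeneousMetricOn (hG : IsWeylPreAmbient r N G) (x₀ : M) :
    IsHomogeneousMetricOn (coordOpens x₀ hG.isOpen) (comp x₀ G) where
  toIsMetricOn := hG.isMetricOn x₀
  homogeneous I J := .of_dilatation (hG.smooth x₀ I J) fun _ hz _ hs =>
    hG.comp_dilatation x₀ I J hs hz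

end IsWeylPreAmbient

namespace IsWeylNormalForm

theorem initial_inf_inf (hA : IsWeylNormalForm r N G A) {t : ℝ} (ht : 0 < t)
    (x : M) : G (t, x, 0) (0, 0, 1) (0, 0, 1) = 0 := by
  rw [hA.initial t x ht 0 0 0 0 1 1]
  simp [tautological]

theorem initial_inf_zero (hA : IsWeylNormalForm r N G A) {t : ℝ} (ht : 0 < t)
    (x : M) : G (t, x, 0) (0, 0, 1) (1, 0, 0) = t := by
  rw [hA.initial t x ht 0 1 0 0 1 0]
  simp [tautological, pow_two, ht.ne']

theorem initial_inf_mid (hA : IsWeylNormalForm r N G A) {t : ℝ} (ht : 0 < t)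
    (x : M) (v : TangentSpace (𝓡 d) x) :
    G (t, x, 0) (0, 0, 1) (0, v, 0) = t ^ 2 * r.a.form x v := by
  rw [hA.initial t x ht 0 0 0 v 1 0]
  simp [tautological]

theorem line_mem (hA : IsWeylNormalForm r N G A) (hG : IsWeylPreAmbient r N G) (x₀ : M) {t ρ : ℝ}
    {y : Eucl d} (hz : ((t, y, ρ) : Coord d) ∈ coordDomain x₀ N) :
    ∀ s ∈ Set.uIcc 0 ρ, ((t, y, s) : Coord d) ∈ coordDomain x₀ N := by
  intro s hs
  obtain ⟨-, hconn, hmem⟩ := hA.interval t ((extChartAt (𝓡 d) x₀).symm y) (hG.pos _ hz.2)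
  exact ⟨hz.1, hconn.uIcc_subset hmem hz.2 hs⟩

variable [IsManifold (𝓡 d) ∞ M]

theorem apply_acceleration (hA : IsWeylNormalForm r N G A) (hG : IsWeylPreAmbient r N G) (x₀ : M)
    (L : Idx d) {z : Coord d} (hz : z ∈ coordDomain x₀ N) :
    G (ambPoint x₀ z) (ambFrame x₀ z L) (A (ambPoint x₀ z)) =
      pd (idxInf d) (comp x₀ G (idxInf d) L) z
        - (1 / 2) * pd L (comp x₀ G (idxInf d) (idxInf d)) z := by
  calc G (ambPoint x₀ z) (ambFrame x₀ z L) (A (ambPoint x₀ z))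
      = ∑ K, comp x₀ G L K z * christoffel (comp x₀ G) K (idxInf d) (idxInf d) z := by
        rw [hA.acceleration x₀ z hz]
        simp only [covDeriv_rhoField, map_sum, map_smul, smul_eq_mul, comp, mul_comm]
    _ = _ := by
        rw [(hG.isMetricOn x₀).sum_mul_christoffel hz]
        ring

theorem comp_inf_inf (hA : IsWeylNormalForm r N G A) (hG : IsWeylPreAmbient r N G) (x₀ : M) :
    Set.EqOn (comp x₀ G (idxInf d) (idxInf d)) (fun _ => 0) (coordDomain x₀ N) := by
  rintro ⟨t, y, ρ⟩ hz
  have hline := hA.line_mem hG x₀ hz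
  refine (eq_of_pd_rho_eq_zero (Ω := coordOpens x₀ hG.isOpen) (hG.smooth x₀ _ _) hline
    fun s hs => ?_).trans (hA.initial_inf_inf (hG.pos _ hz.2) _)
  have horth := (hA.apply_acceleration hG x₀ (idxInf d) (hline s hs)).symm.trans
    (hA.orthogonal_tangent _ (hline s hs).2)
  linarith

theorem pd_rho_comp_inf (hA : IsWeylNormalForm r N G A) (hG : IsWeylPreAmbient r N G) (x₀ : M)
    (L : Idx d) {z : Coord d} (hz : z ∈ coordDomain x₀ N) :
    pd (idxInf d) (comp x₀ G (idxInf d) L) z =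
      G (ambPoint x₀ z) (A (ambPoint x₀ z)) (ambFrame x₀ z L) := by
  rw [hG.apply_comm hz.2, hA.apply_acceleration hG x₀ L hz,
    pd_congr (Ω := coordOpens x₀ hG.isOpen) (hA.comp_inf_inf hG x₀) L hz, pd_const]
  ring

theorem comp_inf_zero (hA : IsWeylNormalForm r N G A) (hG : IsWeylPreAmbient r N G) (x₀ : M) :
    Set.EqOn (comp x₀ G (idxInf d) (idxZero d)) (fun z => z.1) (coordDomain x₀ N) := by
  rintro ⟨t, y, ρ⟩ hz
  have ht : 0 < t := hG.pos _ hz.2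
  have hline := hA.line_mem hG x₀ hz
  refine (eq_of_pd_rho_eq_zero (Ω := coordOpens x₀ hG.isOpen) (hG.smooth x₀ _ _) hline
    fun s hs => ?_).trans (hA.initial_inf_zero ht _)
  have hscale : (((t, 0, 0) : Tan (d := d) (ambPoint x₀ ((t, y, s) : Coord d)))) =
      t • ambFrame x₀ ((t, y, s) : Coord d) (idxZero d) := by
    change _ = t • ((1, 0, 0) : Tan (d := d) (ambPoint x₀ ((t, y, s) : Coord d)))
    simp
  have horth : G (ambPoint x₀ (t, y, s)) (t, 0, 0) (A (ambPoint x₀ (t, y, s))) = 0 :=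
    hA.orthogonal_dilatation _ (hline s hs).2
  rw [hG.apply_comm (hline s hs).2, hscale, map_smul, smul_eq_mul,
    ← hA.pd_rho_comp_inf hG x₀ _ (hline s hs)] at horth
  exact (mul_eq_zero.1 horth).resolve_left ht.ne'

theorem pd_rho_sum_comp_inf_mid (hA : IsWeylNormalForm r N G A) (hG : IsWeylPreAmbient r N G)
    (x₀ : M) (c : Fin d → ℝ) {z : Coord d} (hz : z ∈ coordDomain x₀ N) :
    pd (idxInf d) (fun z => ∑ i, c i * comp x₀ G (idxInf d) (idxMid i) z) z =
      G (ambPoint x₀ z) (A (ambPoint x₀ z)) (0, ∑ i, c i • coordVec x₀ z.2.1 i, 0) := by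
  have hdiff (i : Fin d) : DifferentiableAt ℝ (comp x₀ G (idxInf d) (idxMid i)) z :=
    differentiableAt_of_contDiffOn (Ω := coordOpens x₀ hG.isOpen) (hG.smooth x₀ _ _) hz
  rw [pd_sum _ fun i _ => (hdiff i).const_mul (c i)]
  simp only [pd_const_mul (hdiff _), hA.pd_rho_comp_inf hG x₀ _ hz]
  exact (apply_sum_smul_mid (G (ambPoint x₀ z)) _ c _).symm

theorem integral_acceleration (hA : IsWeylNormalForm r N G A) (hG : IsWeylPreAmbient r N G)
    {t ρ : ℝ} {x : M} (hz : (t, x, ρ) ∈ N) (v : TangentSpace (𝓡 d) x) :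
    ∫ s in (0 : ℝ)..ρ, G (t, x, s) (A (t, x, s)) (0, v, 0) =
      G (t, x, ρ) (0, 0, 1) (0, v, 0) - t ^ 2 * r.a.form x v := by
  obtain ⟨x₀, y, hy, rfl⟩ : ∃ x₀, ∃ y ∈ (extChartAt (𝓡 d) x₀).target,
      (extChartAt (𝓡 d) x₀).symm y = x :=
    ⟨x, extChartAt (𝓡 d) x x, mem_extChartAt_target x, extChartAt_to_inv x⟩
  obtain ⟨c, rfl⟩ := exists_eq_sum_coordVec x₀ hy v
  have hline := hA.line_mem hG x₀ (y := y) ⟨hy, hz⟩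
  have hcomp (s : ℝ) : G (t, (extChartAt (𝓡 d) x₀).symm y, s) (0, 0, 1)
      (0, ∑ i, c i • coordVec x₀ y i, 0) =
      ∑ i, c i * comp x₀ G (idxInf d) (idxMid i) (t, y, s) :=
    apply_sum_smul_mid (G (t, (extChartAt (𝓡 d) x₀).symm y, s)) _ c _
  rw [← hA.initial_inf_mid (hG.pos _ hz), hcomp, hcomp, ← integral_pd_rho
    (Ω := coordOpens x₀ hG.isOpen) (f := fun z => ∑ i, c i * comp x₀ G (idxInf d) (idxMid i) z)
    (ContDiffOn.sum fun i _ => contDiffOn_const.mul (hG.smooth x₀ _ _)) hline]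
  exact intervalIntegral.integral_congr fun s hs =>
    (hA.pd_rho_sum_comp_inf_mid hG x₀ c (hline s hs)).symm

theorem apply_inf_inf (hA : IsWeylNormalForm r N G A) (hG : IsWeylPreAmbient r N G)
    {z : ℝ × M × ℝ} (hz : z ∈ N) : G z (0, 0, 1) (0, 0, 1) = 0 := by
  obtain ⟨x₀, z', hz', rfl⟩ := exists_ambPoint_eq (d := d) hz
  exact hA.comp_inf_inf hG x₀ hz'

theorem apply_inf_zero (hA : IsWeylNormalForm r N G A) (hG : IsWeylPreAmbient r N G)
    {z : ℝ × M × ℝ} (hz : z ∈ N) : G z (0, 0, 1) (1, 0, 0) = z.1 := by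
  obtain ⟨x₀, z', hz', rfl⟩ := exists_ambPoint_eq (d := d) hz
  exact hA.comp_inf_zero hG x₀ hz'

theorem isNormalMetricOn (hA : IsWeylNormalForm r N G A) (hG : IsWeylPreAmbient r N G) (x₀ : M) :
    IsNormalMetricOn (coordOpens x₀ hG.isOpen) (comp x₀ G) where
  toIsHomogeneousMetricOn := hG.isHomogeneousMetricOn x₀
  pos _ hz := hG.pos _ hz.2
  zero_inf := ((hG.isMetricOn x₀).symm _ _).trans (hA.comp_inf_zero hG x₀)

theorem agreesToOrder_zero (hA : IsWeylNormalForm r N G A) (hG : IsWeylPreAmbient r N G) (x₀ : M) :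
    AgreesToOrder (coordOpens x₀ hG.isOpen) (comp x₀ G) 0 := by
  have h := hA.isNormalMetricOn hG x₀
  have hlapse : ContDiffOn ℝ ∞ (lapse (comp x₀ G))
      (coordOpens x₀ hG.isOpen : Opens (Coord d)) :=
    (h.contDiffOn (idxZero d) (idxZero d)).sub (contDiffOn_const.mul contDiffOn_rho)
  refine ⟨⟨hlapse, ?_, contDiffOn_pd hlapse _⟩,
    fun i => ⟨h.contDiffOn _ _, ?_, contDiffOn_pd (h.contDiffOn _ _) _⟩⟩
  · rintro ⟨t, y, ρ⟩ hz (rfl : ρ = 0)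
    have hzero : comp x₀ G (idxZero d) (idxZero d) (t, y, 0) = 0 :=
      hG.apply_zero_of_rho_eq_zero (hG.pos _ hz.2) _ (1, 0)
    simp [lapse, hzero]
  · rintro ⟨t, y, ρ⟩ hz (rfl : ρ = 0)
    exact hG.apply_zero_of_rho_eq_zero (hG.pos _ hz.2) _ (0, coordVec x₀ y i)

theorem agreesToOrder (hA : IsWeylNormalForm r N G A) (hG : IsWeylAmbient r N G) (x₀ : M) {m : ℕ}
    (hm : Odd d ∨ 2 * m ≤ d) : AgreesToOrder (coordOpens x₀ hG.isOpen) (comp x₀ G) m := by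
  have h := hA.isNormalMetricOn hG.toIsWeylPreAmbient x₀
  refine h.agreesToOrder (hA.agreesToOrder_zero hG.toIsWeylPreAmbient x₀) (fun k J => ?_) hm
  refine IsORho.of_iteratedFDeriv (h.contDiffOn_ricci _ _) ?_
  rintro k - ⟨t, y, ρ⟩ hz (rfl : ρ = 0)
  exact hG.ricciFlat k x₀ t y (hG.pos _ hz.2) hz.1 _ J k le_rfl

end IsWeylNormalForm

end NormalForm

/-! ### Comparison with the Weyl-ambient metric -/

section Families

variable {d p q : ℕ} {M : Type*} [TopologicalSpace M] [ChartedSpace (Eucl d) M]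
  {r : WeylPair d M p q} {N : Set (ℝ × M × ℝ)} {G : BilinField d M}

/-- The inclusion of the tangent vectors of `M` into those of `ℝ₊ × M × ℝ`. -/
def inclMid (V : Type*) [AddCommGroup V] [Module ℝ V] : V →ₗ[ℝ] ℝ × V × ℝ :=
  LinearMap.inr ℝ ℝ (V × ℝ) ∘ₗ LinearMap.inl ℝ V ℝ

/-- The family of one-forms `a_i(x, ρ)`, read off at `t = 1` as `G_{∞i}(1, x, ρ)`. -/
def familyForm (G : BilinField d M) (x : M) (ρ : ℝ) : TangentSpace (𝓡 d) x →ₗ[ℝ] ℝ :=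
  G (1, x, ρ) (0, 0, 1) ∘ₗ inclMid (TangentSpace (𝓡 d) x)

/-- The family of bilinear forms `g_ij(x, ρ)`, read off at `t = 1` as `G_ij(1, x, ρ)`. -/
def familyMetric (G : BilinField d M) (x : M) (ρ : ℝ) :
    LinearMap.BilinForm ℝ (TangentSpace (𝓡 d) x) :=
  (G (1, x, ρ)).compl₁₂ (inclMid (TangentSpace (𝓡 d) x)) (inclMid (TangentSpace (𝓡 d) x))

/-- The difference of `G` and the Weyl-ambient metric of the families read off from `G`. -/
def ambientDefect (G : BilinField d M) : BilinField d M :=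
  fun z => G z - weylAmbientForm (familyForm G) (familyMetric G) z

theorem familyForm_apply (G : BilinField d M) (x : M) (ρ : ℝ) (v : TangentSpace (𝓡 d) x) :
    familyForm G x ρ v = G (1, x, ρ) (0, 0, 1) (0, v, 0) := rfl

theorem familyMetric_apply (G : BilinField d M) (x : M) (ρ : ℝ) (v w : TangentSpace (𝓡 d) x) :
    familyMetric G x ρ v w = G (1, x, ρ) (0, v, 0) (0, w, 0) := rfl

theorem weylAmbientForm_apply (a : ∀ x : M, ℝ → TangentSpace (𝓡 d) x →ₗ[ℝ] ℝ)
    (g : ∀ x : M, ℝ → LinearMap.BilinForm ℝ (TangentSpace (𝓡 d) x)) (t : ℝ) (x : M) (ρ : ℝ)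
    (τ σ : ℝ) (v w : TangentSpace (𝓡 d) x) (α β : ℝ) :
    weylAmbientForm a g (t, x, ρ) (τ, v, α) (σ, w, β) = 2 * ρ * (τ * σ)
      + t ^ 2 * (α * (t⁻¹ * σ + a x ρ w) + (t⁻¹ * τ + a x ρ v) * β) + t ^ 2 * g x ρ v w := rfl

theorem weylAmbientForm_apply_zero (a : ∀ x : M, ℝ → TangentSpace (𝓡 d) x →ₗ[ℝ] ℝ)
    (g : ∀ x : M, ℝ → LinearMap.BilinForm ℝ (TangentSpace (𝓡 d) x)) (t : ℝ) (x : M) (ρ : ℝ)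
    (σ : ℝ) (w : TangentSpace (𝓡 d) x) :
    weylAmbientForm a g (t, x, ρ) (1, 0, 0) (σ, w, 0) = 2 * ρ * σ := by
  rw [weylAmbientForm_apply, map_zero, map_zero, LinearMap.zero_apply]
  ring

theorem comp_ambientDefect_zero_zero (G : BilinField d M) (x₀ : M) :
    comp x₀ (ambientDefect G) (idxZero d) (idxZero d) = lapse (comp x₀ G) :=
  funext fun z => congrArg (comp x₀ G (idxZero d) (idxZero d) z - ·)
    ((weylAmbientForm_apply_zero _ _ z.1 _ z.2.2 1 0).trans (mul_one _))

theorem comp_ambientDefect_zero_mid (G : BilinField d M) (x₀ : M) (i : Fin d) :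
    comp x₀ (ambientDefect G) (idxZero d) (idxMid i) = comp x₀ G (idxZero d) (idxMid i) :=
  funext fun z => (congrArg (comp x₀ G (idxZero d) (idxMid i) z - ·)
    ((weylAmbientForm_apply_zero _ _ z.1 _ z.2.2 0 (coordVec x₀ z.2.1 i)).trans
      (mul_zero _))).trans (sub_zero _)

namespace IsWeylPreAmbient

theorem smoothFamilies (hG : IsWeylPreAmbient r N G) :
    SmoothFamilies N (familyForm G) (familyMetric G) := by
  intro x₀
  have hslice : ContDiff ℝ ∞ (fun y : Eucl d × ℝ => ((1, y.1, y.2) : Coord d)) :=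
    contDiff_const.prodMk (contDiff_fst.prodMk contDiff_snd)
  have hcomp (I J : Idx d) : ContDiffOn ℝ ∞ (fun y : Eucl d × ℝ => comp x₀ G I J (1, y.1, y.2))
      {y | y.1 ∈ (extChartAt (𝓡 d) x₀).target ∧
        ∃ t : ℝ, (t, (extChartAt (𝓡 d) x₀).symm y.1, y.2) ∈ N} :=
    (hG.smooth x₀ I J).comp hslice.contDiffOn fun y hy => ⟨hy.1, hG.one_mem hy.2.choose_spec⟩
  exact ⟨fun i => hcomp (idxInf d) (idxMid i), fun i j => hcomp (idxMid i) (idxMid j)⟩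

theorem familyMetric_isSymm (hG : IsWeylPreAmbient r N G) {t ρ : ℝ} {x : M}
    (hz : (t, x, ρ) ∈ N) : (familyMetric G x ρ).IsSymm :=
  ⟨fun _ _ => hG.apply_comm (hG.one_mem hz) _ _⟩

theorem familyMetric_zero (hG : IsWeylPreAmbient r N G) (x : M) :
    familyMetric G x 0 = r.g.form x := by
  ext v w
  rw [familyMetric_apply, hG.pullback 1 x one_pos (0, v) (0, w)]
  simp [tautological]

theorem mid_mid_eq_weylAmbientForm (hG : IsWeylPreAmbient r N G) {z : ℝ × M × ℝ} (hz : z ∈ N)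
    (v w : TangentSpace (𝓡 d) z.2.1) :
    G z (0, v, 0) (0, w, 0) =
      weylAmbientForm (familyForm G) (familyMetric G) z (0, v, 0) (0, w, 0) := by
  obtain ⟨t, x, ρ⟩ := z
  rw [weylAmbientForm_apply, hG.apply_inr hz, familyMetric_apply]
  ring

theorem weylAmbientForm_comm (hG : IsWeylPreAmbient r N G) {z : ℝ × M × ℝ} (hz : z ∈ N)
    (v w : Tan (d := d) z) :
    weylAmbientForm (familyForm G) (familyMetric G) z v w =
      weylAmbientForm (familyForm G) (familyMetric G) z w v := by
  obtain ⟨t, x, ρ⟩ := z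
  obtain ⟨τ, v, α⟩ := v
  obtain ⟨σ, w, β⟩ := w
  rw [weylAmbientForm_apply, weylAmbientForm_apply, (hG.familyMetric_isSymm hz).eq v w]
  ring

theorem comp_ambientDefect_comm (hG : IsWeylPreAmbient r N G) (x₀ : M) (I J : Idx d) :
    Set.EqOn (comp x₀ (ambientDefect G) I J) (comp x₀ (ambientDefect G) J I)
      (coordDomain x₀ N) := fun _ hz =>
  congrArg₂ (· - ·) (hG.apply_comm hz.2 _ _) (hG.weylAmbientForm_comm hz.2 _ _)

end IsWeylPreAmbient

namespace IsWeylNormalForm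

variable {A : ∀ z : ℝ × M × ℝ, Tan (d := d) z} [IsManifold (𝓡 d) ∞ M]

theorem familyForm_eq (hA : IsWeylNormalForm r N G A) (hG : IsWeylPreAmbient r N G)
    {t ρ : ℝ} {x : M} (hz : (t, x, ρ) ∈ N) (v : TangentSpace (𝓡 d) x) :
    familyForm G x ρ v = r.a.form x v
      + (t ^ 2)⁻¹ * ∫ ρ' in (0 : ℝ)..ρ, G (t, x, ρ') (A (t, x, ρ')) (0, v, 0) := by
  have ht : t ≠ 0 := (hG.pos _ hz).ne'
  rw [hA.integral_acceleration hG hz v, hG.apply_inr hz, familyForm_apply]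
  field_simp
  ring

theorem inf_eq_weylAmbientForm (hA : IsWeylNormalForm r N G A) (hG : IsWeylPreAmbient r N G)
    {z : ℝ × M × ℝ} (hz : z ∈ N) (w : Tan (d := d) z) :
    G z (0, 0, 1) w = weylAmbientForm (familyForm G) (familyMetric G) z (0, 0, 1) w := by
  obtain ⟨t, x, ρ⟩ := z
  obtain ⟨σ, w, β⟩ := w
  have ht : t ≠ 0 := (hG.pos _ hz).ne'
  have hw : ((σ, w, β) : Tan (d := d) (t, x, ρ)) = σ • (1, 0, 0) + (0, w, 0) + β • (0, 0, 1) := by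
    simp
  rw [weylAmbientForm_apply, hw, map_add, map_add, map_smul, map_smul, hA.apply_inf_inf hG hz,
    hA.apply_inf_zero hG hz, familyForm_apply, hG.apply_inr hz]
  simp only [smul_eq_mul, map_zero, LinearMap.zero_apply]
  field_simp
  ring

theorem isORho_ambientDefect (hA : IsWeylNormalForm r N G A) (hG : IsWeylAmbient r N G) (x₀ : M)
    {m : ℕ} (hm : Odd d ∨ 2 * m ≤ d) (I J : Idx d) :
    IsORho (coordOpens x₀ hG.isOpen) (m + 1) (comp x₀ (ambientDefect G) I J) := by
  have hP := hG.toIsWeylPreAmbient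
  have h := hA.agreesToOrder hG x₀ hm
  have hinf (J : Idx d) : IsORho (coordOpens x₀ hG.isOpen) (m + 1)
      (comp x₀ (ambientDefect G) (idxInf d) J) :=
    IsORho.zero.congr fun z hz => sub_eq_zero.2 (hA.inf_eq_weylAmbientForm hP hz.2 _)
  have hzero_mid (i : Fin d) : IsORho (coordOpens x₀ hG.isOpen) (m + 1)
      (comp x₀ (ambientDefect G) (idxZero d) (idxMid i)) :=
    comp_ambientDefect_zero_mid G x₀ i ▸ h.shift i
  rcases I with _ | i | _ <;> rcases J with _ | j | _
  · exact comp_ambientDefect_zero_zero G x₀ ▸ h.lapse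
  · exact hzero_mid j
  · exact (hinf _).congr (hP.comp_ambientDefect_comm x₀ _ _)
  · exact (hzero_mid i).congr (hP.comp_ambientDefect_comm x₀ _ _)
  · exact IsORho.zero.congr fun z hz =>
      sub_eq_zero.2 (hP.mid_mid_eq_weylAmbientForm hz.2 _ _)
  · exact (hinf _).congr (hP.comp_ambientDefect_comm x₀ _ _)
  all_goals exact hinf _

theorem vanishesToOrder_ambientDefect (hA : IsWeylNormalForm r N G A) (hG : IsWeylAmbient r N G)
    {m : ℕ} (hm : Odd d ∨ 2 * m ≤ d) :
    VanishesToOrder (fun x₀ : M => comp x₀ (ambientDefect G)) m :=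
  fun x₀ t _ ht hy I J _ hk => ((hA.isORho_ambientDefect hG x₀ hm I J).mono
    (Nat.succ_le_succ hk)).iteratedFDeriv_eq_zero ⟨hy, hG.contains_zero t _ ht⟩ rfl

end IsWeylNormalForm

end Families

end WeylAmbient

end

/-- Let `[g, a]` be a Weyl class on a `d`-dimensional manifold `M`, let `r = (g, a)` be any of its
representatives, and let `(N, G)` be a Weyl-ambient space in Weyl-normal form with acceleration `A`.
Then `G = 2 ρ dt² + 2 t² dρ (dt / t + a_i(x, ρ) dx^i) + t² g_ij(x, ρ) dx^i dx^j`, where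
`a_i(x, ρ) = a_i(x) + t⁻² ∫₀^ρ A_i(t, x, ρ') dρ'`: the components `∞I` and `ij` agree on all of `N`,
and the remaining equations `G_00 = 2 ρ`, `G_0i = 0` hold to all orders at `ρ = 0` if `d` is odd,
and to order `d / 2` if `d` is even. -/
theorem mainTheorem2 {d p q : ℕ} {M : Type*} [TopologicalSpace M]
    [ChartedSpace (WeylAmbient.Eucl d) M] [IsManifold (𝓡 d) ∞ M]
    (C : Set (WeylAmbient.WeylPair d M p q)) (hC : WeylAmbient.IsWeylClass C)
    (r : WeylAmbient.WeylPair d M p q) (hr : r ∈ C)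
    (N : Set (ℝ × M × ℝ)) (G : WeylAmbient.BilinField d M)
    (A : ∀ z : ℝ × M × ℝ, WeylAmbient.Tan (d := d) z)
    (hG : WeylAmbient.IsWeylAmbient r N G)
    (hA : WeylAmbient.IsWeylNormalForm r N G A) :
    ∃ (a : ∀ x : M, ℝ → TangentSpace (𝓡 d) x →ₗ[ℝ] ℝ)
      (g : ∀ x : M, ℝ → LinearMap.BilinForm ℝ (TangentSpace (𝓡 d) x)),
      WeylAmbient.SmoothFamilies N a g ∧
      (∀ (t : ℝ) (x : M) (ρ : ℝ), (t, x, ρ) ∈ N → ∀ v : TangentSpace (𝓡 d) x,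
        a x ρ v = r.a.form x v
          + (t ^ 2)⁻¹ * ∫ ρ' in (0 : ℝ)..ρ, G (t, x, ρ') (A (t, x, ρ')) (0, v, 0)) ∧
      (∀ (t : ℝ) (x : M) (ρ : ℝ), (t, x, ρ) ∈ N → (g x ρ).IsSymm) ∧
      (∀ x : M, g x 0 = r.g.form x) ∧
      (∀ z ∈ N, ∀ w : WeylAmbient.Tan (d := d) z,
        G z (0, 0, 1) w = WeylAmbient.weylAmbientForm a g z (0, 0, 1) w) ∧
      (∀ z ∈ N, ∀ v w : TangentSpace (𝓡 d) z.2.1,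
        G z (0, v, 0) (0, w, 0) = WeylAmbient.weylAmbientForm a g z (0, v, 0) (0, w, 0)) ∧
      (∀ m : ℕ, (Odd d ∨ 2 * m ≤ d) →
        WeylAmbient.VanishesToOrder
          (fun x₀ : M => WeylAmbient.comp x₀
            (fun z => G z - WeylAmbient.weylAmbientForm a g z)) m) := by
  have hP := hG.toIsWeylPreAmbient
  exact ⟨WeylAmbient.familyForm G, WeylAmbient.familyMetric G, hP.smoothFamilies,
    fun _ _ _ hz v => hA.familyForm_eq hP hz v, fun _ _ _ hz => hP.familyMetric_isSymm hz,
    hP.familyMetric_zero, fun _ hz w => hA.inf_eq_weylAmbientForm hP hz w,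
    fun _ hz v w => hP.mid_mid_eq_weylAmbientForm hz v w,
    fun _ hm => hA.vanishesToOrder_ambientDefect hG hm⟩
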